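/- All quivers are finite (finitely many vertices and arrows; loops and multiple arrows are allowed), and graph-theoretic notions such as connected, tree and cycle refer to the underlying undirected multigraph. A quiver is of type $\tilde{\mathbb A}_n$ ($n\ge 0$) if its underlying graph is a cycle with $n+1$ vertices (a loop if $n=0$, a pair of parallel edges if $n=1$). A pseudotree is a connected quiver $Q$ with $\operatorname{rank} H_1(Q,\mathbb Z)\le 1$; it is proper if it is neither a tree nor of type $\tilde{\mathbb A}_n$, and then its central cycle is its unique subquiver of type $\tilde{\mathbb A}_n$. An $\mathbb F_1$-representation $M$ of a quiver $Q$ consists of a finite pointed set $(M_i,0)$ for each vertex $i$ and, for each arrow $\alpha$, a pointed map $f_\alpha : M_{s(\alpha)}\to M_{t(\alpha)}$ that is injective outside $f_\alpha^{-1}(0)$. It is nilpotent if all sufficiently long oriented paths act by zero, and indecomposable if it is non-zero and is not the direct sum of two non-zero subrepresentations. Its coefficient quiver $\Gamma=\Gamma_M$ has the non-zero elements of $M$ as vertices and one arrow $x\to f_\alpha(x)$ for each arrow $\alpha$ and each $x\in M_{s(\alpha)}$ with $f_\alpha(x)\ne 0$; sending $x\in M_i$ to $i$ and this arrow to $\alpha$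 defines the associated winding $c:\Gamma\to Q$. A nice sequence on $M$ is a sequence of maps $\partial_0,\partial_1,\dots:\Gamma_0\to\mathbb Z$ such that for every $i\ge 0$ and all arrows $\beta,\beta'$ of $\Gamma$ with $c(\beta)=c(\beta')$, $\partial_j(s(\beta))=\partial_j(s(\beta'))$ and $\partial_j(t(\beta))=\partial_j(t(\beta'))$ for all $j<i$, one has $\partial_i(t(\beta))-\partial_i(s(\beta))=\partial_i(t(\beta'))-\partial_i(s(\beta'))$. The nice length $\operatorname{nice}(M)$ is the least $n\ge 0$ such that for some nice sequence any two distinct vertices of $\Gamma$ are distinguished by one of $\partial_0,\dots,\partial_n$, and $\operatorname{nice}(M)=\infty$ if there is no such $n$. A cycle $\beta_1^{\delta_1}\cdots\beta_d^{\delta_d}$ in $\Gamma$ (with $\beta_j$ arrows and $\delta_j=\pm1$) is primitive if $c(\beta_1)^{\delta_1}\cdots c(\beta_d)^{\delta_d}\ne q^k$ for every closed walk $q$ in the underlying graph of $Q$ and every $k>1$; if $\Gamma$ is of type $\tilde{\mathbb A}_n$, then $c$ is called primitive if the cycle that makes up $\Gamma$ is. **Theorem E.** Let $Q$ be a quiver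 and $M$ an indecomposable nilpotent $\mathbb F_1$-representation of $Q$ with associated winding $c:\Gamma\to Q$. 1. If $\Gamma$ is a tree, then $\operatorname{nice}(M)<\infty$. 2. If $\Gamma$ is of type $\tilde{\mathbb A}_n$, then $\operatorname{nice}(M)<\infty$ if and only if $c$ is primitive. 3. If $Q$ is a pseudotree, then $\operatorname{nice}(M)<\infty$ if and only if the central cycle of $\Gamma$ is primitive. That is, if $\Gamma$ contains a cycle $p$, then $\operatorname{nice}(M)<\infty$ if and only if $p$ is primitive, and if $\Gamma$ contains no cycle, then $\operatorname{nice}(M)<\infty$. 4. If $Q$ is a proper pseudotree with central cycle $C$, then $\operatorname{nice}(M)<\infty$ if and only if $\operatorname{nice}(\operatorname{Res}_C(M))<\infty$, where $\operatorname{Res}_C(M)$ is the restriction of $M$ to $C$. -/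

import Mathlib

universe u v w

/-- A quiver: finite sets of vertices and arrows, with source and target functions.
Loops and multiple arrows are allowed. -/
structure FinQuiver where
  V : Type u
  A : Type v
  src : A → V
  tgt : A → V
  finite_V : Finite V
  finite_A : Finite A

namespace FinQuiver

/-- A signed arrow: `(a, true)` is `a` traversed forwards, `(a, false)` is `a` traversed backwards,
that is, `a⁻¹`. -/
abbrev SignedArrow (Q : FinQuiver.{u, v}) : Type v := Q.A × Bool

/-- The vertex at which the traversal of a signed arrow starts. -/
def start (Q : FinQuiver.{u, v}) : Q.SignedArrow → Q.V
  | (a, true) => Q.src a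
  | (a, false) => Q.tgt a

/-- The vertex at which the traversal of a signed arrow ends. -/
def finish (Q : FinQuiver.{u, v}) : Q.SignedArrow → Q.V
  | (a, true) => Q.tgt a
  | (a, false) => Q.src a

/-- `Q.IsWalk x p y`: the word `p` of signed arrows is a walk from `x` to `y` in the underlying
undirected graph of `Q`. -/
def IsWalk (Q : FinQuiver.{u, v}) : Q.V → List Q.SignedArrow → Q.V → Prop
  | x, [], y => x = y
  | x, e :: p, y => Q.start e = x ∧ Q.IsWalk (Q.finish e) p y

/-- A closed walk of positive length. -/
def IsClosedWalk (Q : FinQuiver.{u, v}) (p : List Q.SignedArrow) : Prop :=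
  p ≠ [] ∧ ∃ x, Q.IsWalk x p x

/-- A (simple) cycle of the underlying undirected multigraph: a closed walk of positive length
that repeats neither vertices nor edges. Loops are cycles of length `1` and pairs of parallel or
antiparallel arrows give cycles of length `2`. -/
def IsCycle (Q : FinQuiver.{u, v}) (p : List Q.SignedArrow) : Prop :=
  Q.IsClosedWalk p ∧ (p.map Q.start).Nodup ∧ (p.map Prod.fst).Nodup

/-- The quiver is connected and non-empty. -/
def Connected (Q : FinQuiver.{u, v}) : Prop :=
  Nonempty Q.V ∧ ∀ x y : Q.V, ∃ p, Q.IsWalk x p y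

/-- The underlying undirected graph is a tree. -/
def IsTree (Q : FinQuiver.{u, v}) : Prop :=
  Q.Connected ∧ ∀ p, ¬ Q.IsCycle p

/-- `Q = β₁^{δ₁} ⋯ β_d^{δ_d}` as a cycle: `p` is a cycle that runs through all vertices and all
arrows of `Q`. -/
def IsCyclePresentation (Q : FinQuiver.{u, v}) (p : List Q.SignedArrow) : Prop :=
  Q.IsCycle p ∧ (∀ x, x ∈ p.map Q.start) ∧ (∀ a, a ∈ p.map Prod.fst)

/-- `Q` is of type `Ã_n` for some `n ≥ 0`: the underlying undirected graph is a cycle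
(with `n + 1` vertices). -/
def IsAffineA (Q : FinQuiver.{u, v}) : Prop :=
  ∃ p, Q.IsCyclePresentation p

/-- The boundary map `ℤQ₁ → ℤQ₀`, `α ↦ t(α) - s(α)`. -/
noncomputable def boundary (Q : FinQuiver.{u, v}) : (Q.A →₀ ℤ) →ₗ[ℤ] (Q.V →₀ ℤ) :=
  Finsupp.lmapDomain ℤ ℤ Q.tgt - Finsupp.lmapDomain ℤ ℤ Q.src

/-- The integral cycle space `H₁(Q, ℤ)`. -/
noncomputable def H1 (Q : FinQuiver.{u, v}) : Submodule ℤ (Q.A →₀ ℤ) :=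
  LinearMap.ker Q.boundary

/-- Pseudotree: connected, with first homology of rank at most one. -/
def IsPseudotree (Q : FinQuiver.{u, v}) : Prop :=
  Q.Connected ∧ Module.finrank ℤ Q.H1 ≤ 1

/-- Proper pseudotree: a pseudotree that is neither a tree nor of type `Ã_n`. -/
def IsProperPseudotree (Q : FinQuiver.{u, v}) : Prop :=
  Q.IsPseudotree ∧ ¬ Q.IsTree ∧ ¬ Q.IsAffineA

/-- A subquiver: a set of vertices and a set of arrows between them. -/
structure Subquiver (Q : FinQuiver.{u, v}) where
  verts : Set Q.V
  arrows : Set Q.A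
  src_mem : ∀ a ∈ arrows, Q.src a ∈ verts
  tgt_mem : ∀ a ∈ arrows, Q.tgt a ∈ verts

/-- A subquiver as a quiver in its own right. -/
def Subquiver.toFinQuiver {Q : FinQuiver.{u, v}} (C : Q.Subquiver) : FinQuiver.{u, v} where
  V := C.verts
  A := C.arrows
  src a := ⟨Q.src a, C.src_mem a a.2⟩
  tgt a := ⟨Q.tgt a, C.tgt_mem a a.2⟩
  finite_V := by
    have := Q.finite_V
    exact Subtype.finite
  finite_A := by
    have := Q.finite_A
    exact Subtype.finite

/-- A central cycle: a subquiver of type `Ã_n`. (A proper pseudotree has exactly one.) -/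
def Subquiver.IsCentralCycle {Q : FinQuiver.{u, v}} (C : Q.Subquiver) : Prop :=
  C.toFinQuiver.IsAffineA

/-- `Q.DirectedPath n i j`: oriented paths of length `n` from `i` to `j`. -/
inductive DirectedPath (Q : FinQuiver.{u, v}) : ℕ → Q.V → Q.V → Type (max u v)
  | nil (i : Q.V) : DirectedPath Q 0 i i
  | snoc {n : ℕ} {i : Q.V} (a : Q.A) (p : DirectedPath Q n i (Q.src a)) :
      DirectedPath Q (n + 1) i (Q.tgt a)

end FinQuiver

/-- A winding of quivers `S → Q`: a quiver map that is injective on the arrows with a given source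
and on the arrows with a given target. -/
structure Winding (S : FinQuiver.{u, v}) (Q : FinQuiver) where
  onV : S.V → Q.V
  onA : S.A → Q.A
  src_onA : ∀ a, Q.src (onA a) = onV (S.src a)
  tgt_onA : ∀ a, Q.tgt (onA a) = onV (S.tgt a)
  inj_src : ∀ a b, a ≠ b → S.src a = S.src b → onA a ≠ onA b
  inj_tgt : ∀ a b, a ≠ b → S.tgt a = S.tgt b → onA a ≠ onA b

namespace Winding

variable {S : FinQuiver.{u, v}} {Q : FinQuiver}

/-- The image of a walk. -/
def mapWalk (c : Winding S Q) (p : List S.SignedArrow) : List Q.SignedArrow :=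
  p.map fun e => (c.onA e.1, e.2)

/-- A cycle `p` of `S` is primitive for `c` if `c(p)` is not `q ^ k` with `k > 1`, for a closed
walk `q` of `Q`. -/
def IsPrimitiveCycle (c : Winding S Q) (p : List S.SignedArrow) : Prop :=
  ¬ ∃ (k : ℕ) (q : List Q.SignedArrow),
    1 < k ∧ Q.IsClosedWalk q ∧ c.mapWalk p = (List.replicate k q).flatten

/-- A winding whose source is of type `Ã_n` is primitive if the cycle that makes up its source
is primitive. -/
def IsPrimitive (c : Winding S Q) : Prop :=
  ∀ p, S.IsCyclePresentation p → c.IsPrimitiveCycle p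

/-- `g` is a nice `(δ₁, …, δₙ)`-grading. -/
def IsNiceGrading (c : Winding S Q) {n : ℕ} (δ : Fin n → S.V → ℤ) (g : S.V → ℤ) : Prop :=
  ∀ b b' : S.A,
    (∀ i, δ i (S.src b) = δ i (S.src b')) →
    (∀ i, δ i (S.tgt b) = δ i (S.tgt b')) →
    c.onA b = c.onA b' →
    g (S.tgt b) - g (S.src b) = g (S.tgt b') - g (S.src b')

/-- A nice sequence: each `δ i` is a nice `(δ 0, …, δ (i - 1))`-grading; for `i = 0`, a nice
grading. -/
def IsNiceSequence (c : Winding S Q) (δ : ℕ → S.V → ℤ) : Prop :=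
  ∀ i : ℕ, c.IsNiceGrading (fun j : Fin i => δ j) (δ i)

/-- There is a nice sequence for which `(δ 0, …, δ n)` distinguishes the vertices. -/
def DistinguishedBy (c : Winding S Q) (n : ℕ) : Prop :=
  ∃ δ : ℕ → S.V → ℤ, c.IsNiceSequence δ ∧ ∀ x y, x ≠ y → ∃ i ≤ n, δ i x ≠ δ i y

/-- The nice length: the smallest such `n`, and `⊤` if there is none. -/
noncomputable def niceLength (c : Winding S Q) : ℕ∞ :=
  ⨅ (n : ℕ) (_ : c.DistinguishedBy n), (n : ℕ∞)

end Winding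

/-- An `F₁`-linear map between pointed sets: it preserves the base point `0` and is injective off
the fibre of `0`. -/
def IsF1Linear {X Y : Type*} [Zero X] [Zero Y] (f : X → Y) : Prop :=
  f 0 = 0 ∧ Set.InjOn f {x | f x ≠ 0}

/-- A representation of `Q` over `F₁`: a finite pointed set for each vertex and an `F₁`-linear map
for each arrow. -/
structure F1Rep (Q : FinQuiver.{u, v}) where
  X : Q.V → Type w
  [zero : ∀ i, Zero (X i)]
  finite : ∀ i, Finite (X i)
  f : ∀ a : Q.A, X (Q.src a) → X (Q.tgt a)
  linear : ∀ a, IsF1Linear (f a)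

attribute [instance] F1Rep.zero

namespace F1Rep

variable {Q : FinQuiver.{u, v}}

/-- The composite map along an oriented path. -/
def act (M : F1Rep.{u, v, w} Q) {n : ℕ} {i j : Q.V} : Q.DirectedPath n i j → M.X i → M.X j
  | .nil _ => fun x => x
  | .snoc a p => fun x => M.f a (M.act p x)

/-- All sufficiently long oriented paths act by zero. -/
def IsNilpotent (M : F1Rep.{u, v, w} Q) : Prop :=
  ∃ N : ℕ, 0 < N ∧ ∀ n, N ≤ n → ∀ (i j : Q.V) (p : Q.DirectedPath n i j) (x : M.X i),
    M.act p x = 0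

/-- A family of subsets that forms a subrepresentation. -/
def IsSubrep (M : F1Rep.{u, v, w} Q) (W : ∀ i, Set (M.X i)) : Prop :=
  (∀ i, (0 : M.X i) ∈ W i) ∧ ∀ a, ∀ x ∈ W (Q.src a), M.f a x ∈ W (Q.tgt a)

/-- `M` is non-zero, and whenever `M` is the direct sum of two subrepresentations, one of them is
zero. -/
def IsIndecomposable (M : F1Rep.{u, v, w} Q) : Prop :=
  (∃ i, ∃ x : M.X i, x ≠ 0) ∧
  ∀ W W' : ∀ i, Set (M.X i), M.IsSubrep W → M.IsSubrep W' →
    (∀ i, W i ∪ W' i = Set.univ) → (∀ i, W i ∩ W' i = {0}) →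
    (∀ i, W i = {0}) ∨ (∀ i, W' i = {0})

theorem ne_zero_of_map_ne_zero (M : F1Rep.{u, v, w} Q) (a : Q.A) {x : M.X (Q.src a)}
    (h : M.f a x ≠ 0) : x ≠ 0 := by
  rintro rfl
  exact h (M.linear a).1

/-- The coefficient quiver `Γ_M`: its vertices are the non-zero elements of `M`, and there is an
arrow from `x` to `f_α(x)` for each arrow `α` of `Q` and each `x` with `f_α(x) ≠ 0`. -/
def coeffQuiver (M : F1Rep.{u, v, w} Q) : FinQuiver.{max u w, max v w} where
  V := Σ i : Q.V, {x : M.X i // x ≠ 0}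
  A := Σ a : Q.A, {x : M.X (Q.src a) // M.f a x ≠ 0}
  src b := ⟨Q.src b.1, b.2.1, M.ne_zero_of_map_ne_zero b.1 b.2.2⟩
  tgt b := ⟨Q.tgt b.1, M.f b.1 b.2.1, b.2.2⟩
  finite_V := by
    have := Q.finite_V
    have := M.finite
    infer_instance
  finite_A := by
    have := Q.finite_A
    have := M.finite
    infer_instance

/-- The winding `c : Γ_M → Q` associated with `M`. -/
def winding (M : F1Rep.{u, v, w} Q) : Winding M.coeffQuiver Q where
  onV x := x.1
  onA b := b.1
  src_onA _ := rfl
  tgt_onA _ := rfl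
  inj_src := by
    rintro ⟨a, x, hx⟩ ⟨a', y, hy⟩ hne hs h
    obtain rfl : a = a' := h
    apply hne
    simp only [coeffQuiver, Sigma.mk.injEq, heq_eq_eq, Subtype.mk.injEq, true_and] at hs
    subst hs
    rfl
  inj_tgt := by
    rintro ⟨a, x, hx⟩ ⟨a', y, hy⟩ hne ht h
    obtain rfl : a = a' := h
    apply hne
    simp only [coeffQuiver, Sigma.mk.injEq, heq_eq_eq, Subtype.mk.injEq, true_and] at ht
    obtain rfl : x = y := (M.linear a).2 hx hy ht
    rfl

/-- The nice length of `M`. -/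
noncomputable def nice (M : F1Rep.{u, v, w} Q) : ℕ∞ := M.winding.niceLength

/-- The restriction of `M` to a subquiver `C`. -/
def res (M : F1Rep.{u, v, w} Q) (C : Q.Subquiver) : F1Rep.{u, v, w} C.toFinQuiver where
  X i := M.X i.1
  zero i := M.zero i.1
  finite i := M.finite i.1
  f a := M.f a.1
  linear a := M.linear a.1

end F1Rep

/-!
Let `c : Γ → Q` be the winding of `M`; since `M` is indecomposable, `Γ` is connected
(`F1Rep.connected_coeffQuiver`). Take a nice sequence that separates as many pairs of vertices as
possible. It yields a map `κ` on `Γ₀` that no further nice grading refines, and `nice(M) < ∞` as soon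
as every such `κ` is injective (`Winding.niceLength_lt_top_of_isStable`). Nice gradings relative to
`κ` are the potentials of those weights on the arrows of the quotient `Γ / κ` that vanish on the
images of all closed walks of `Γ`, and `Γ → Γ / κ` is again a winding (`Winding.toQuotient`).

* `Γ` a tree: all weights are allowed. If `κ` identifies two vertices, then a shortest walk between
  such vertices maps to a cycle of `Γ / κ` (`Winding.exists_walk_isCycle`), and the indicator of an
  arrow of this cycle separates its ends.
* `Γ` a cycle: a weight is allowed if it vanishes on the image `u` of the cycle. By linear duality
  the chain of every closed segment of this image is proportional to `u`, so all simple closed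
  segments have the same arrows, namely the support of `u`. A reduced periodic walk with this
  property runs round and round one cycle (`FinQuiver.exists_period_isSimpleSegment`). If the cycle
  is primitive, it runs round only once, that is, `κ` is injective.
* A cycle of `Γ` that is not primitive has a rotation compatible with `c`. Every function of a nice
  sequence is invariant under it: inductively, its change under the rotation is constant, and the
  changes add up to zero (`Winding.nice_eq_of_period`). This only uses the arrows of the cycle, so
  it applies to any `Γ`, and to the restriction of `M` to a subquiver that contains the image.
* `Q` a pseudotree: any two closed walks of `Q` have proportional chains, since `H₁(Q, ℤ)` has rank
  at most one. So the periodicity argument applies to `c` itself, and a primitive cycle of `Γ` maps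
  to a cycle of `Q`. Then `c` is injective on vertices
  (`Winding.onV_injective_of_isCycle_mapWalk`), and the weights on the arrows of `Q` that vanish on
  this cycle separate all vertices, because the chain of a walk with distinct ends has non-zero
  boundary.
* The restriction to the central cycle `C`: a nice sequence on `M` restricts, and each cycle of `Γ`
  lies over `C`, so that it is primitive if the restriction has finite nice length.
-/

universe u' v'

/-! ### Walks and their chains -/

namespace FinQuiver

variable {Q : FinQuiver.{u, v}}

theorem isWalk_append {x y : Q.V} {p q : List Q.SignedArrow} :
    Q.IsWalk x (p ++ q) y ↔ ∃ z, Q.IsWalk x p z ∧ Q.IsWalk z q y := by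
  induction p generalizing x with
  | nil => simp [IsWalk]
  | cons e p ih => simp [IsWalk, ih, and_assoc]

theorem start_not (e : Q.SignedArrow) : Q.start (e.1, !e.2) = Q.finish e := by
  rcases e with ⟨a, _ | _⟩ <;> rfl

theorem finish_not (e : Q.SignedArrow) : Q.finish (e.1, !e.2) = Q.start e := by
  rcases e with ⟨a, _ | _⟩ <;> rfl

theorem eq_or_eq_not {A : Type*} {e e' : A × Bool} (h : e.1 = e'.1) :
    e' = e ∨ e' = (e.1, !e.2) := by
  rcases e with ⟨a, _ | _⟩ <;> rcases e' with ⟨a', _ | _⟩ <;> simp_all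

/-- The chain `∑ ± a` of a walk, in which an arrow counts with the sign of its traversal. -/
noncomputable def chain (Q : FinQuiver.{u, v}) : List Q.SignedArrow → (Q.A →₀ ℤ)
  | [] => 0
  | e :: p => Finsupp.single e.1 (if e.2 then 1 else -1) + chain Q p

theorem chain_append (p q : List Q.SignedArrow) : Q.chain (p ++ q) = Q.chain p + Q.chain q := by
  induction p with
  | nil => simp [chain]
  | cons e p ih => simp [chain, ih, add_assoc]

theorem boundary_chain {x y : Q.V} {p : List Q.SignedArrow} (h : Q.IsWalk x p y) :
    Q.boundary (Q.chain p) = Finsupp.single y 1 - Finsupp.single x 1 := by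
  induction p generalizing x with
  | nil =>
    obtain rfl : x = y := h
    simp [chain]
  | cons e p ih =>
    obtain ⟨rfl, h⟩ := h
    rw [chain, map_add, ih h]
    have hb : ∀ (a : Q.A) (r : ℤ), Q.boundary (Finsupp.single a r) =
        Finsupp.single (Q.tgt a) r - Finsupp.single (Q.src a) r := fun a r => by
      simp [boundary]
    rw [hb]
    rcases e with ⟨a, _ | _⟩ <;> simp [start, finish, neg_add_eq_sub]

theorem chain_mem_H1 {x : Q.V} {p : List Q.SignedArrow} (h : Q.IsWalk x p x) :
    Q.chain p ∈ Q.H1 := by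
  rw [H1, LinearMap.mem_ker, boundary_chain h, sub_self]

theorem chain_apply_eq_zero {p : List Q.SignedArrow} {a : Q.A} (h : a ∉ p.map Prod.fst) :
    Q.chain p a = 0 := by
  induction p with
  | nil => simp [chain]
  | cons e p ih =>
    simp only [List.map_cons, List.mem_cons, not_or] at h
    rw [chain, Finsupp.add_apply, ih h.2, Finsupp.single_eq_of_ne h.1, add_zero]

theorem chain_apply_ne_zero_iff {p : List Q.SignedArrow} (hp : (p.map Prod.fst).Nodup) {a : Q.A} :
    Q.chain p a ≠ 0 ↔ a ∈ p.map Prod.fst := by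
  refine ⟨fun h => by_contra fun h' => h (chain_apply_eq_zero h'), fun h => ?_⟩
  induction p with
  | nil => simp at h
  | cons e p ih =>
    rw [List.map_cons, List.nodup_cons] at hp
    rw [chain, Finsupp.add_apply]
    by_cases ha : a = e.1
    · rw [ha, chain_apply_eq_zero hp.1, Finsupp.single_eq_same]
      split_ifs <;> simp
    · rw [Finsupp.single_eq_of_ne ha, zero_add]
      exact ih hp.2 (by simpa [ha] using h)

theorem linearCombination_indicator {ι : Type*} [DecidableEq ι] (a : ι →₀ ℤ) (i : ι) :
    Finsupp.linearCombination ℤ (Pi.single (M := fun _ => ℤ) i 1 : ι → ℤ) a = a i := by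
  rw [Finsupp.linearCombination_apply, Finsupp.sum, Finset.sum_eq_single i]
  · simp
  · intro b _ hb
    rw [Pi.single_eq_of_ne hb, smul_zero]
  · intro h
    simp [Finsupp.notMem_support_iff.mp h]

/-- Duality over `ℤ`: if every integral functional that kills `b` kills `a`, then some non-zero
multiple of `a` is a multiple of `b`. -/
theorem exists_smul_eq_smul {ι : Type*} (a b : ι →₀ ℤ)
    (h : ∀ W : ι → ℤ, Finsupp.linearCombination ℤ W b = 0 →
      Finsupp.linearCombination ℤ W a = 0) :
    ∃ m n : ℤ, m ≠ 0 ∧ m • a = n • b := by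
  classical
  by_cases hb : b = 0
  · subst hb
    refine ⟨1, 0, one_ne_zero, ?_⟩
    ext i
    have := h (Pi.single i 1) (by simp)
    rw [linearCombination_indicator] at this
    simp [this]
  · obtain ⟨i, hi⟩ := Finsupp.ne_iff.mp hb
    refine ⟨b i, a i, hi, ?_⟩
    ext j
    -- the functional `b i • e j - b j • e i` kills `b`
    have key : ∀ c : ι →₀ ℤ, Finsupp.linearCombination ℤ
        (b i • (Pi.single j 1 : ι → ℤ) - b j • (Pi.single i 1 : ι → ℤ)) c
          = b i * c j - b j * c i := by
      intro c
      rw [← linearCombination_indicator c j, ← linearCombination_indicator c i]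
      simp only [Finsupp.linearCombination_apply, Finsupp.sum, Finset.mul_sum,
        ← Finset.sum_sub_distrib]
      refine Finset.sum_congr rfl fun k _ => ?_
      simp only [Pi.sub_apply, Pi.smul_apply, smul_eq_mul]
      ring
    have := h _ ((key b).trans (by ring))
    rw [key] at this
    simp only [Finsupp.smul_apply, smul_eq_mul]
    linarith

/-- In a pseudotree any two elements of the cycle space are linearly dependent. -/
theorem IsPseudotree.exists_smul_eq_smul (hQ : Q.IsPseudotree) {a b : Q.A →₀ ℤ}
    (ha : a ∈ Q.H1) (hb : b ∈ Q.H1) : ∃ m n : ℤ, (m ≠ 0 ∨ n ≠ 0) ∧ m • a = n • b := by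
  by_contra! hcon
  have := Q.finite_A
  have hli : LinearIndependent ℤ ![(⟨a, ha⟩ : Q.H1), ⟨b, hb⟩] := by
    rw [LinearIndependent.pair_iff]
    intro s t hst
    have hst' : s • a = (-t) • b := by
      have := congrArg Subtype.val hst
      simp only [Submodule.coe_add, Submodule.coe_smul, Submodule.coe_zero] at this
      rw [neg_smul]
      exact eq_neg_of_add_eq_zero_left this
    by_contra h
    rw [not_and_or] at h
    exact hcon s (-t) (by simpa using h) hst'
  have := hli.fintype_card_le_finrank
  have h2 := hQ.2
  simp at this
  omega

/-- In a pseudotree the chain of every closed walk is proportional to that of a given closed walk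
without repeated arrows. -/
theorem IsPseudotree.exists_smul_chain_eq (hQ : Q.IsPseudotree) {x y : Q.V}
    {p q : List Q.SignedArrow} (hp : Q.IsWalk x p x) (hq : Q.IsWalk y q y)
    (hq' : (q.map Prod.fst).Nodup) (hq0 : q ≠ []) :
    ∃ m n : ℤ, m ≠ 0 ∧ m • Q.chain p = n • Q.chain q := by
  obtain ⟨m, n, hmn, h⟩ := hQ.exists_smul_eq_smul (chain_mem_H1 hp) (chain_mem_H1 hq)
  refine ⟨m, n, ?_, h⟩
  rintro rfl
  obtain ⟨e, he⟩ := List.exists_mem_of_ne_nil q hq0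
  have h1 := (chain_apply_ne_zero_iff hq').mpr (List.mem_map_of_mem he)
  have h2 := DFunLike.congr_fun h e.1
  simp only [zero_smul, Finsupp.smul_apply, smul_eq_mul, Finsupp.coe_zero, Pi.zero_apply] at h2
  simp [(mul_eq_zero.mp h2.symm).resolve_right h1] at hmn

/-- In a pseudotree any two closed walks without repeated arrows run through the same arrows. -/
theorem IsPseudotree.mem_arrows (hQ : Q.IsPseudotree) {x y : Q.V}
    {p q : List Q.SignedArrow} (hp : Q.IsWalk x p x) (hq : Q.IsWalk y q y)
    (hp' : (p.map Prod.fst).Nodup) (hq' : (q.map Prod.fst).Nodup) (hq0 : q ≠ [])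
    {a : Q.A} (ha : a ∈ p.map Prod.fst) : a ∈ q.map Prod.fst := by
  obtain ⟨m, n, hm, h⟩ := hQ.exists_smul_chain_eq hp hq hq' hq0
  by_contra hqa
  have h1 := DFunLike.congr_fun h a
  rw [Finsupp.smul_apply, Finsupp.smul_apply, chain_apply_eq_zero hqa, smul_zero,
    smul_eq_mul] at h1
  exact (chain_apply_ne_zero_iff hp').mpr ha ((mul_eq_zero.mp h1).resolve_left hm)

/-- Along a walk, a potential changes by the weight of the chain of the walk. -/
theorem linearCombination_chain {W : Q.A → ℤ} {g : Q.V → ℤ}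
    (hg : ∀ b, g (Q.tgt b) - g (Q.src b) = W b) {x y : Q.V} {p : List Q.SignedArrow}
    (h : Q.IsWalk x p y) : Finsupp.linearCombination ℤ W (Q.chain p) = g y - g x := by
  induction p generalizing x with
  | nil =>
    obtain rfl : x = y := h
    simp [chain]
  | cons e p ih =>
    obtain ⟨rfl, h⟩ := h
    rw [chain, map_add, ih h, Finsupp.linearCombination_single]
    rcases e with ⟨a, _ | _⟩ <;> simp [start, finish, ← hg]

/-- A weight on the arrows that vanishes on all closed walks has a potential. -/
theorem Connected.exists_potential (hQ : Q.Connected) (W : Q.A → ℤ)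
    (hW : ∀ x p, Q.IsWalk x p x → Finsupp.linearCombination ℤ W (Q.chain p) = 0) :
    ∃ g : Q.V → ℤ, ∀ b, g (Q.tgt b) - g (Q.src b) = W b := by
  obtain ⟨⟨x₀⟩, hconn⟩ := hQ
  choose p hp using hconn x₀
  refine ⟨fun x => Finsupp.linearCombination ℤ W (Q.chain (p x)), fun b => ?_⟩
  obtain ⟨r, hr⟩ := hconn (Q.tgt b) x₀
  have h1 := hW x₀ (p (Q.tgt b) ++ r) (isWalk_append.mpr ⟨_, hp _, hr⟩)
  have h2 := hW x₀ (p (Q.src b) ++ (b, true) :: r)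
    (isWalk_append.mpr ⟨_, hp _, rfl, hr⟩)
  simp only [chain_append, chain, map_add, Finsupp.linearCombination_single] at h1 h2
  simp at h2
  linarith

theorem exists_split_of_not_nodup {α β : Type*} (f : α → β) {l : List α}
    (h : ¬ (l.map f).Nodup) : ∃ a e b e' c, l = a ++ e :: (b ++ e' :: c) ∧ f e = f e' := by
  induction l with
  | nil => simp at h
  | cons e t ih =>
    by_cases he : f e ∈ t.map f
    · obtain ⟨e', he', hf⟩ := List.mem_map.mp he
      obtain ⟨b, c, rfl⟩ := List.append_of_mem he'
      exact ⟨[], e, b, e', c, rfl, hf.symm⟩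
    · rw [List.map_cons, List.nodup_cons] at h
      obtain ⟨a, e₁, b, e', c, rfl, hf⟩ := ih fun h' => h ⟨he, h'⟩
      exact ⟨e :: a, e₁, b, e', c, rfl, hf⟩

/-- A closed walk without repeated vertices is a cycle, unless it goes forth and back along one
arrow. -/
theorem nodup_arrows_or_eq {x : Q.V} {p : List Q.SignedArrow} (hp : Q.IsWalk x p x)
    (hs : (p.map Q.start).Nodup) :
    (p.map Prod.fst).Nodup ∨ ∃ e, p = [e, (e.1, !e.2)] := by
  refine or_iff_not_imp_left.mpr fun h => ?_
  obtain ⟨a, e, b, e', c, rfl, he⟩ := exists_split_of_not_nodup _ h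
  have hne : Q.start e ≠ Q.start e' := by
    intro h
    simp [List.nodup_append, h] at hs
  obtain rfl : e' = (e.1, !e.2) := by
    rcases eq_or_eq_not he with h | h
    · exact absurd (by rw [h]) hne
    · exact h
  obtain ⟨y, ha, rfl, h⟩ := isWalk_append.mp hp
  obtain ⟨z, hb, rfl, hc⟩ := isWalk_append.mp h
  rw [start_not] at hb hne
  rw [finish_not] at hc
  obtain rfl : b = [] := by
    rcases b with _ | ⟨f, b⟩
    · rfl
    · have := hb.1
      simp [List.nodup_append, start_not, this] at hs
  obtain rfl : c = [] := by
    rcases c with _ | ⟨f, c⟩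
    · rfl
    · have := hc.1
      simp [List.nodup_append, start_not, this] at hs
  obtain rfl : Q.start e = x := hc
  obtain rfl : a = [] := by
    rcases a with _ | ⟨f, a⟩
    · rfl
    · have := ha.1
      simp [List.nodup_append, start_not, this] at hs
  exact ⟨e, rfl⟩

/-- Without cycles, every closed walk has chain zero: it decomposes into walks that go forth and
back along one arrow. -/
theorem chain_eq_zero_of_acyclic (hQ : ∀ p, ¬ Q.IsCycle p) {x : Q.V} {p : List Q.SignedArrow}
    (hp : Q.IsWalk x p x) : Q.chain p = 0 := by
  induction hn : p.length using Nat.strong_induction_on generalizing x p with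
  | _ n ih =>
    by_cases hs : (p.map Q.start).Nodup
    · rcases nodup_arrows_or_eq hp hs with h | ⟨⟨a, s⟩, rfl⟩
      · by_cases hp0 : p = []
        · rw [hp0, chain]
        · exact absurd ⟨⟨hp0, x, hp⟩, hs, h⟩ (hQ p)
      · cases s <;> simp [chain]
    · obtain ⟨a, e, b, e', c, rfl, he⟩ := exists_split_of_not_nodup _ hs
      obtain ⟨y, ha, rfl, h⟩ := isWalk_append.mp hp
      obtain ⟨z, hb, rfl, hc⟩ := isWalk_append.mp h
      simp only [List.length_append, List.length_cons] at hn
      have h1 := ih (e :: b).length (by simp; omega) (x := Q.start e) (p := e :: b)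
        ⟨rfl, he ▸ hb⟩ rfl
      have h2 := ih (a ++ e' :: c).length (by simp; omega) (x := x) (p := a ++ e' :: c)
        (isWalk_append.mpr ⟨_, ha, he.symm, hc⟩) rfl
      rw [chain_append] at h2
      rw [← List.cons_append, chain_append, chain_append, h1, zero_add, h2]

end FinQuiver

/-! ### Infinite walks and the periodicity of walks with one cycle -/

namespace FinQuiver

variable {Q : FinQuiver.{u, v}}

/-- An infinite walk, indexed by `ℕ`. Cycles are encoded as periodic infinite walks. -/
def IsInfiniteWalk (Q : FinQuiver.{u, v}) (L : ℕ → Q.SignedArrow) : Prop :=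
  ∀ i, Q.finish (L i) = Q.start (L (i + 1))

/-- The `n` steps of an infinite walk that begin with step `s`. -/
def steps (L : ℕ → Q.SignedArrow) (s n : ℕ) : List Q.SignedArrow := (List.range' s n).map L

/-- An infinite walk that never goes forth and at once back along an arrow. -/
def IsReduced (L : ℕ → Q.SignedArrow) : Prop :=
  ∀ i, L (i + 1) ≠ ((L i).1, !(L i).2)

/-- The segment of length `n` that begins with step `s` is closed, and visits no vertex twice
before it closes. -/
def IsSimpleSegment (L : ℕ → Q.SignedArrow) (s n : ℕ) : Prop :=
  0 < n ∧ Q.start (L (s + n)) = Q.start (L s) ∧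
    ∀ i j, s ≤ i → i < j → j < s + n → Q.start (L i) ≠ Q.start (L j)

theorem IsInfiniteWalk.isWalk_steps {L : ℕ → Q.SignedArrow} (hL : Q.IsInfiniteWalk L)
    (s n : ℕ) : Q.IsWalk (Q.start (L s)) (steps L s n) (Q.start (L (s + n))) := by
  induction n generalizing s with
  | zero => rfl
  | succ n ih =>
    rw [steps, List.range'_succ, List.map_cons]
    refine ⟨rfl, ?_⟩
    rw [hL s, show s + (n + 1) = s + 1 + n by omega]
    exact ih (s + 1)

theorem steps_ne_nil {L : ℕ → Q.SignedArrow} {s n : ℕ} (hn : 0 < n) : steps L s n ≠ [] := by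
  simp [steps, hn.ne']

theorem mem_steps {L : ℕ → Q.SignedArrow} {s n : ℕ} {a : Q.A} :
    a ∈ (steps L s n).map Prod.fst ↔ ∃ i, s ≤ i ∧ i < s + n ∧ (L i).1 = a := by
  simp only [steps, List.map_map, List.mem_map, List.mem_range'_1, Function.comp, and_assoc]

/-- If `L` has period `m`, then a segment of length `k * m` is a `k`-th power. -/
theorem steps_mul {L : ℕ → Q.SignedArrow} {m : ℕ} (h : ∀ i, L (i + m) = L i) (k : ℕ) :
    steps L 0 (k * m) = (List.replicate k (steps L 0 m)).flatten := by
  have key : ∀ n, steps L (0 + m) n = steps L 0 n := fun n => by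
    simp only [steps, List.range'_eq_map_range, List.map_map]
    refine List.map_congr_left fun i _ => ?_
    simp only [Function.comp]
    rw [zero_add, zero_add, add_comm, h]
  induction k with
  | zero => simp [steps]
  | succ k ih =>
    rw [List.replicate_succ, List.flatten_cons, ← ih, ← key (k * m), steps, steps, steps,
      ← List.map_append, List.range'_append_1, add_mul, one_mul, add_comm]

theorem IsSimpleSegment.nodup_arrows {L : ℕ → Q.SignedArrow} (hL : Q.IsInfiniteWalk L)
    (hred : IsReduced L) {s n : ℕ} (h : IsSimpleSegment L s n) :
    ((steps L s n).map Prod.fst).Nodup := by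
  have key : ∀ i j, s ≤ i → i < j → j < s + n → (L i).1 ≠ (L j).1 := by
    intro i j hi hij hj he
    rcases eq_or_eq_not he with h' | h'
    · exact h.2.2 i j hi hij hj (by rw [h'])
    · have h1 : Q.start (L j) = Q.start (L (i + 1)) := by rw [h', start_not, hL]
      rcases (show i + 1 ≤ j from hij).eq_or_lt with rfl | hlt
      · exact hred i h'
      · exact h.2.2 (i + 1) j (by omega) hlt hj h1.symm
  rw [steps, List.map_map]
  refine List.Nodup.map_on ?_ (List.nodup_range' ..)
  intro i hi j hj he
  rw [List.mem_range'_1] at hi hj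
  rcases lt_trichotomy i j with h' | h' | h'
  · exact absurd he (key i j hi.1 h' hj.2)
  · exact h'
  · exact absurd he.symm (key j i hj.1 h' hi.2)

/-- Suppose that all simple closed segments of a reduced periodic walk run through the same arrows.
Then the walk runs round and round a single cycle. -/
theorem exists_period_isSimpleSegment {L : ℕ → Q.SignedArrow} (hL : Q.IsInfiniteWalk L)
    (hred : IsReduced L) {d : ℕ} (hd : 0 < d) (hper : ∀ i, L (i + d) = L i)
    (H : ∀ s n s' n', IsSimpleSegment L s n → IsSimpleSegment L s' n' →
      ∀ a ∈ (steps L s n).map Prod.fst, a ∈ (steps L s' n').map Prod.fst) :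
    ∃ m, m ∣ d ∧ (∀ i, L (i + m) = L i) ∧ ∀ i, IsSimpleSegment L i m := by
  classical
  -- a shortest closed segment is simple
  have hex : ∃ m, 0 < m ∧ ∃ s, Q.start (L (s + m)) = Q.start (L s) := ⟨d, hd, 0, by rw [hper]⟩
  obtain ⟨hm, s₀, hs₀⟩ := Nat.find_spec hex
  have hmin := fun {k} => Nat.find_min hex (m := k)
  generalize Nat.find hex = m at hm hs₀ hmin
  have h0 : IsSimpleSegment L s₀ m := by
    refine ⟨hm, hs₀, fun i j hi hij hj he => hmin (k := j - i) (by omega) ⟨by omega, i, ?_⟩⟩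
    rw [Nat.add_sub_cancel' hij.le, he]
  have step : ∀ i, IsSimpleSegment L i m → L (i + m) = L i ∧ IsSimpleSegment L (i + 1) m := by
    intro i hi
    have hfin : L (i + m) = L i → IsSimpleSegment L (i + 1) m := by
      intro h
      refine ⟨hm, by rw [add_right_comm, ← hL, h, hL], fun j k hj hjk hk he => ?_⟩
      rcases (show k ≤ i + m by omega).eq_or_lt with rfl | hk'
      · exact hi.2.2 i j le_rfl (by omega) (by omega) (by rw [he, h])
      · exact hi.2.2 j k (by omega) hjk hk' he
    suffices h : L (i + m) = L i from ⟨h, hfin h⟩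
    -- `t` is the first time at which the walk that begins with step `i + 1` meets itself
    have hex' : ∃ t, ∃ s, i + 1 ≤ s ∧ s < t ∧ Q.start (L t) = Q.start (L s) :=
      ⟨i + 1 + d, i + 1, le_rfl, by omega, by rw [hper]⟩
    obtain ⟨s, his, hst, hts⟩ := Nat.find_spec hex'
    have hmin' := fun {k} => Nat.find_min hex' (m := k)
    generalize Nat.find hex' = t at hst hts hmin'
    have hinj : ∀ j k, i + 1 ≤ j → j < t → i + 1 ≤ k → k < t →
        Q.start (L j) = Q.start (L k) → j = k := by
      intro j k hj hjt hk hkt he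
      by_contra hne
      rcases lt_or_gt_of_ne hne with h | h
      · exact hmin' hkt ⟨j, hj, h, he.symm⟩
      · exact hmin' hjt ⟨k, hk, h, he⟩
    have hsimple : IsSimpleSegment L s (t - s) := by
      refine ⟨by omega, by rw [Nat.add_sub_cancel' hst.le, hts], fun j k hj hjk hk he => ?_⟩
      have := hinj j k (by omega) (by omega) (by omega) (by omega) he
      omega
    obtain ⟨r, hsr, hrt, hr⟩ := mem_steps.mp
      (H i m s (t - s) hi hsimple (L i).1 (mem_steps.mpr ⟨i, le_rfl, by omega, rfl⟩))
    have hrm : i + m ≤ r := by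
      by_contra hlt
      have hnd := hi.nodup_arrows hL hred
      rw [steps, List.map_map, List.nodup_map_iff_inj_on (List.nodup_range' ..)] at hnd
      have := hnd i (by rw [List.mem_range'_1]; omega) r (by rw [List.mem_range'_1]; omega) hr.symm
      omega
    rcases eq_or_eq_not hr.symm with h | h
    · have : r = i + m :=
        hinj r (i + m) (by omega) (by omega) (by omega) (by omega) (by rw [h, hi.2.1])
      rw [← this, h]
    · have : r = i + 1 :=
        hinj r (i + 1) (by omega) (by omega) (by omega) (by omega) (by rw [h, start_not, hL])
      exact absurd (this ▸ h) (hred i)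
  have hall : ∀ j, IsSimpleSegment L (s₀ + j) m := fun j => by
    induction j with
    | zero => exact h0
    | succ j ih => exact (step _ ih).2
  have hshift : ∀ k i, L (i + k * d) = L i := fun k i => by
    induction k with
    | zero => simp
    | succ k ih => rw [add_mul, one_mul, ← add_assoc, hper, ih]
  have hle : s₀ ≤ s₀ * d := Nat.le_mul_of_pos_right _ hd
  have hmper : ∀ i, L (i + m) = L i := fun i => by
    have := (step _ (hall (i + s₀ * d - s₀))).1
    rw [show s₀ + (i + s₀ * d - s₀) = i + s₀ * d by omega, add_right_comm, hshift, hshift] at this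
    exact this
  have hsimple : ∀ i, IsSimpleSegment L i m := by
    intro i
    have h := hall (i + s₀ * d - s₀)
    rw [show s₀ + (i + s₀ * d - s₀) = i + s₀ * d by omega] at h
    refine ⟨hm, by rw [hmper], fun j k hj hjk hk he => ?_⟩
    exact h.2.2 (j + s₀ * d) (k + s₀ * d) (by omega) (by omega) (by omega)
      (by rw [hshift, hshift, he])
  refine ⟨m, ?_, hmper, hsimple⟩
  have hmshift : ∀ k i, L (i + k * m) = L i := fun k i => by
    induction k with
    | zero => simp
    | succ k ih => rw [add_mul, one_mul, ← add_assoc, hmper, ih]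
  refine Nat.dvd_of_mod_eq_zero (by_contra fun hne => ?_)
  refine (hsimple 0).2.2 0 (d % m) le_rfl (by omega) (by have := Nat.mod_lt d hm; omega) ?_
  rw [← hmshift (d / m) (d % m), mul_comm, Nat.mod_add_div, ← hper 0, zero_add]

/-- A closed walk, run through again and again. -/
theorem exists_infiniteWalk {x : Q.V} {p : List Q.SignedArrow} (hp : Q.IsWalk x p x)
    (hp0 : p ≠ []) : ∃ e : ℕ → Q.SignedArrow, Q.IsInfiniteWalk e ∧
      (∀ i, e (i + p.length) = e i) ∧ steps e 0 p.length = p := by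
  have hd : 0 < p.length := List.length_pos_iff.mpr hp0
  have hwalk : ∀ (p : List Q.SignedArrow) (x y : Q.V), Q.IsWalk x p y →
      (∀ h : 0 < p.length, Q.start p[0] = x) ∧
      (∀ i (h : i + 1 < p.length), Q.finish p[i] = Q.start p[i + 1]) ∧
      (∀ i (h : i + 1 = p.length), Q.finish p[i] = y) := by
    intro p
    induction p with
    | nil => intro x y _; simp
    | cons e p ih =>
      intro x y h
      obtain ⟨h1, h2, h3⟩ := ih _ _ h.2
      refine ⟨fun _ => h.1, fun i hi => ?_, fun i hi => ?_⟩
      · rcases i with _ | i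
        · exact (h1 (by simpa using hi)).symm
        · exact h2 i (by simpa using hi)
      · rcases i with _ | i
        · have : p = [] := by simpa using hi
          subst this
          exact h.2
        · exact h3 i (by simpa using hi)
  obtain ⟨h1, h2, h3⟩ := hwalk p x x hp
  refine ⟨fun i => p[i % p.length]'(Nat.mod_lt _ hd), fun i => ?_, fun i => by simp, ?_⟩
  · have hlt := Nat.mod_lt i hd
    rcases (show i % p.length + 1 ≤ p.length from hlt).eq_or_lt with h | h
    · have h' : (i + 1) % p.length = 0 := by
        rw [← Nat.mod_add_mod, h, Nat.mod_self]
      simp only [h']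
      rw [h3 _ h, h1 hd]
    · have h' : (i + 1) % p.length = i % p.length + 1 := by
        rw [← Nat.mod_add_mod, Nat.mod_eq_of_lt h]
      simp only [h']
      exact h2 _ h
  · apply List.ext_getElem
    · simp [steps]
    · intro i hi hi'
      simp [steps, Nat.mod_eq_of_lt hi']

theorem nodup_map_steps {β : Type*} {L : ℕ → Q.SignedArrow} {f : Q.SignedArrow → β} {d : ℕ}
    (h : ((steps L 0 d).map f).Nodup) {i j : ℕ} (hi : i < d) (hj : j < d)
    (he : f (L i) = f (L j)) : i = j := by
  rw [steps, List.map_map, List.nodup_map_iff_inj_on (List.nodup_range' ..)] at h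
  exact h i (by rw [List.mem_range'_1]; omega) j (by rw [List.mem_range'_1]; omega) he

theorem eq_mod_of_periodic {β : Type*} {L : ℕ → β} {d : ℕ} (hper : ∀ i, L (i + d) = L i) (i : ℕ) :
    L (i % d) = L i :=
  Function.Periodic.map_mod_nat hper i

/-- A cycle, run through again and again, meets a vertex or an arrow only once in each round. -/
theorem IsCycle.exists_infiniteWalk {p : List Q.SignedArrow} (hp : Q.IsCycle p) :
    ∃ e : ℕ → Q.SignedArrow, Q.IsInfiniteWalk e ∧ (∀ i, e (i + p.length) = e i) ∧
      steps e 0 p.length = p ∧ 0 < p.length ∧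
      (∀ i j, Q.start (e i) = Q.start (e j) → i % p.length = j % p.length) ∧
      (∀ i j, (e i).1 = (e j).1 → i % p.length = j % p.length) := by
  obtain ⟨⟨hp0, x, hx⟩, hs, ha⟩ := hp
  obtain ⟨e, he, hper, hseg⟩ := FinQuiver.exists_infiniteWalk hx hp0
  have hd : 0 < p.length := List.length_pos_iff.mpr hp0
  generalize p.length = d at *
  subst hseg
  refine ⟨e, he, hper, rfl, hd, fun i j h => ?_, fun i j h => ?_⟩
  · refine nodup_map_steps hs (Nat.mod_lt _ hd) (Nat.mod_lt _ hd) ?_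
    rw [eq_mod_of_periodic hper, eq_mod_of_periodic hper, h]
  · refine nodup_map_steps ha (Nat.mod_lt _ hd) (Nat.mod_lt _ hd) ?_
    rw [eq_mod_of_periodic hper, eq_mod_of_periodic hper, h]

end FinQuiver

/-! ### Windings and primitive cycles -/

namespace Winding

open FinQuiver

variable {S : FinQuiver.{u, v}} {Q : FinQuiver.{u', v'}} (c : Winding S Q)

/-- The image of a signed arrow. -/
def letter (e : S.SignedArrow) : Q.SignedArrow := (c.onA e.1, e.2)

theorem start_letter (e : S.SignedArrow) : Q.start (c.letter e) = c.onV (S.start e) := by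
  rcases e with ⟨a, _ | _⟩
  · exact c.tgt_onA a
  · exact c.src_onA a

theorem finish_letter (e : S.SignedArrow) : Q.finish (c.letter e) = c.onV (S.finish e) := by
  rcases e with ⟨a, _ | _⟩
  · exact c.src_onA a
  · exact c.tgt_onA a

theorem mapWalk_steps (e : ℕ → S.SignedArrow) (s n : ℕ) :
    c.mapWalk (steps e s n) = steps (fun i => c.letter (e i)) s n := by
  simp [mapWalk, steps, letter]

theorem isWalk_mapWalk {x y : S.V} {p : List S.SignedArrow} (h : S.IsWalk x p y) :
    Q.IsWalk (c.onV x) (c.mapWalk p) (c.onV y) := by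
  induction p generalizing x with
  | nil =>
    obtain rfl : x = y := h
    rfl
  | cons e p ih =>
    obtain ⟨rfl, h⟩ := h
    refine ⟨c.start_letter e, ?_⟩
    have := ih h
    rw [← c.finish_letter] at this
    exact this

/-- A winding reflects equality of signed arrows with the same start. -/
theorem letter_injective {e e' : S.SignedArrow} (hs : S.start e = S.start e')
    (h : c.letter e = c.letter e') : e = e' := by
  rcases e with ⟨a, s⟩
  rcases e' with ⟨a', s'⟩
  obtain ⟨h, rfl⟩ := Prod.mk.inj h
  by_contra hne
  have hne' : a ≠ a' := by
    rintro rfl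
    exact hne rfl
  cases s
  · exact c.inj_tgt _ _ hne' hs h
  · exact c.inj_src _ _ hne' hs h

theorem isInfiniteWalk_letter {e : ℕ → S.SignedArrow} (he : S.IsInfiniteWalk e) :
    Q.IsInfiniteWalk fun i => c.letter (e i) := fun i => by
  rw [finish_letter, start_letter, he]

theorem isReduced_letter {e : ℕ → S.SignedArrow} (he : S.IsInfiniteWalk e) (hr : IsReduced e) :
    IsReduced fun i => c.letter (e i) := fun i h => by
  refine hr i (c.letter_injective ?_ h)
  rw [start_not, he]

theorem linearCombination_mapWalk (W : Q.A → ℤ) (p : List S.SignedArrow) :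
    Finsupp.linearCombination ℤ W (Q.chain (c.mapWalk p)) =
      Finsupp.linearCombination ℤ (fun b => W (c.onA b)) (S.chain p) := by
  induction p with
  | nil => simp [mapWalk, chain]
  | cons e p ih =>
    change Finsupp.linearCombination ℤ W (Q.chain (c.letter e :: c.mapWalk p)) = _
    rw [chain, chain, map_add, map_add, ih, Finsupp.linearCombination_single,
      Finsupp.linearCombination_single]
    rfl

/-- A walk between distinct vertices with the same image contains, up to shortcuts, such a walk
that maps to a cycle: one takes a shortest one. It cannot map to a walk that goes forth and back
along one arrow, since a winding is locally injective. -/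
theorem exists_walk_isCycle {x y : S.V} {p : List S.SignedArrow} (hp : S.IsWalk x p y)
    (hxy : x ≠ y) (hc : c.onV x = c.onV y) :
    ∃ x' y' p', S.IsWalk x' p' y' ∧ x' ≠ y' ∧ c.onV x' = c.onV y' ∧ Q.IsCycle (c.mapWalk p') ∧
      p' ⊆ p := by
  induction hn : p.length using Nat.strong_induction_on generalizing x y p with
  | _ n ih =>
    have hw := c.isWalk_mapWalk hp
    rw [← hc] at hw
    have hmap : (c.mapWalk p).map Q.start = p.map fun e => c.onV (S.start e) := by
      simp only [mapWalk, List.map_map]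
      exact List.map_congr_left fun e _ => c.start_letter e
    by_cases hs : (p.map fun e => c.onV (S.start e)).Nodup
    · rcases nodup_arrows_or_eq hw (by rwa [hmap]) with h | ⟨f, hf⟩
      · refine ⟨x, y, p, hp, hxy, hc, ⟨⟨?_, _, hw⟩, by rwa [hmap], h⟩, List.Subset.refl _⟩
        rintro h0
        obtain rfl : p = [] := by simpa [mapWalk] using h0
        exact hxy hp
      · obtain ⟨e, p, rfl, rfl, h2⟩ := List.map_eq_cons_iff.mp hf
        obtain ⟨e', p, rfl, h3, h4⟩ := List.map_eq_cons_iff.mp h2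
        obtain rfl : p = [] := List.map_eq_nil_iff.mp h4
        obtain ⟨rfl, he', rfl⟩ := hp
        have : e' = (e.1, !e.2) := c.letter_injective (by rw [he', start_not]) h3
        rw [this, finish_not] at hxy
        exact absurd rfl hxy
    · obtain ⟨a, e, b, e', t, rfl, he⟩ := exists_split_of_not_nodup _ hs
      obtain ⟨y₁, ha, rfl, h⟩ := isWalk_append.mp hp
      obtain ⟨z₁, hb, rfl, ht⟩ := isWalk_append.mp h
      simp only [List.length_append, List.length_cons] at hn
      by_cases hee : S.start e = S.start e'
      · obtain ⟨x', y', p', h1, h2, h3, h4, h5⟩ := ih (a ++ e' :: t).length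
          (by simp; omega) (p := a ++ e' :: t)
          (isWalk_append.mpr ⟨_, ha, hee.symm, ht⟩) hxy hc rfl
        exact ⟨x', y', p', h1, h2, h3, h4, List.Subset.trans h5 (by intro f; simp; tauto)⟩
      · obtain ⟨x', y', p', h1, h2, h3, h4, h5⟩ := ih (e :: b).length
          (by simp; omega) (p := e :: b) ⟨rfl, hb⟩ hee he rfl
        exact ⟨x', y', p', h1, h2, h3, h4, List.Subset.trans h5 (by intro f; simp; tauto)⟩

theorem isReduced_of_cycle {e : ℕ → S.SignedArrow} {d : ℕ} (hper : ∀ i, e (i + d) = e i)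
    (ha : ∀ i j, (e i).1 = (e j).1 → i % d = j % d) : IsReduced e := by
  intro i h
  have h1 : (i + 1) % d = i % d := ha _ _ (by rw [h])
  rw [← eq_mod_of_periodic hper (i + 1), h1, eq_mod_of_periodic hper] at h
  have := congrArg Prod.snd h
  simp at this

/-- The word of a cycle is not primitive if it has a proper period. -/
theorem not_isPrimitiveCycle {e : ℕ → S.SignedArrow} (he : S.IsInfiniteWalk e) {d m : ℕ}
    (hd : 0 < d) (hmd : m ∣ d) (hne : m ≠ d) (hm : ∀ i, c.letter (e (i + m)) = c.letter (e i)) :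
    ¬ c.IsPrimitiveCycle (steps e 0 d) := by
  obtain ⟨k, rfl⟩ := hmd
  have hm0 : 0 < m := Nat.pos_of_mul_pos_right hd
  refine not_not.mpr ⟨k, steps (fun i => c.letter (e i)) 0 m, ?_,
    ⟨steps_ne_nil hm0, Q.start (c.letter (e 0)), ?_⟩, ?_⟩
  · have : k ≠ 0 := by
      rintro rfl
      simp at hd
    have : k ≠ 1 := by
      rintro rfl
      simp at hne
    omega
  · have := (c.isInfiniteWalk_letter he).isWalk_steps 0 m
    simp only [hm] at this
    exact this
  · rw [mapWalk_steps, mul_comm, steps_mul hm]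

/-- The word of a cycle that is not primitive has a proper period. -/
theorem exists_period_of_not_isPrimitiveCycle {e : ℕ → S.SignedArrow} {d : ℕ} (hd : 0 < d)
    (hper : ∀ i, e (i + d) = e i) (h : ¬ c.IsPrimitiveCycle (steps e 0 d)) :
    ∃ m k, 0 < m ∧ 1 < k ∧ d = k * m ∧ ∀ i, c.letter (e (i + m)) = c.letter (e i) := by
  obtain ⟨k, q, hk, hq, h⟩ := not_not.mp h
  rw [mapWalk_steps] at h
  have hlen : d = k * q.length := by simpa [steps] using congrArg List.length h
  have hq0 : 0 < q.length := List.length_pos_iff.mpr hq.1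
  refine ⟨q.length, k, hq0, hk, hlen, ?_⟩
  -- the letters of `q`, repeated
  have hrep : ∀ (k i : ℕ) (hi : i < k * q.length),
      (List.replicate k q).flatten[i]? = q[i % q.length]? := by
    intro k
    induction k with
    | zero => simp
    | succ k ih =>
      intro i hi
      rw [List.replicate_succ, List.flatten_cons]
      rcases lt_or_ge i q.length with hlt | hge
      · rw [List.getElem?_append_left hlt, Nat.mod_eq_of_lt hlt]
      · rw [List.getElem?_append_right hge, ih _ (by rw [add_mul, one_mul] at hi; omega),
          ← Nat.mod_eq_sub_mod hge]
  have hlet : ∀ i, some (c.letter (e i)) = q[i % q.length]? := by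
    intro i
    rw [← eq_mod_of_periodic hper i]
    have hlt := Nat.mod_lt i hd
    have := hrep k (i % d) (hlen ▸ hlt)
    rw [← h, Nat.mod_mod_of_dvd _ (Dvd.intro_left k hlen.symm)] at this
    rw [← this]
    simp [steps, hlt]
  intro i
  apply Option.some_injective
  rw [hlet, hlet, Nat.add_mod_right]

/-- If all simple closed segments in the image of a primitive cycle run through the same arrows,
then the image is itself a cycle. The winding `c'` may be finer than the winding `c` for which the
cycle is primitive. -/
theorem isSimpleSegment_of_isPrimitiveCycle {e : ℕ → S.SignedArrow} (he : S.IsInfiniteWalk e)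
    {d : ℕ} (hd : 0 < d) (hper : ∀ i, e (i + d) = e i)
    (ha : ∀ i j, (e i).1 = (e j).1 → i % d = j % d) {c : Winding S Q}
    {R : FinQuiver} {c' : Winding S R}
    (hc : ∀ b b', c'.onA b = c'.onA b' → c.onA b = c.onA b')
    (hp : c.IsPrimitiveCycle (steps e 0 d))
    (H : ∀ s n s' n', IsSimpleSegment (fun i => c'.letter (e i)) s n →
      IsSimpleSegment (fun i => c'.letter (e i)) s' n' →
      ∀ a ∈ (steps (fun i => c'.letter (e i)) s n).map Prod.fst,
        a ∈ (steps (fun i => c'.letter (e i)) s' n').map Prod.fst) :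
    IsSimpleSegment (fun i => c'.letter (e i)) 0 d := by
  obtain ⟨m, hmd, hm, hsimple⟩ := exists_period_isSimpleSegment (c'.isInfiniteWalk_letter he)
    (c'.isReduced_letter he (isReduced_of_cycle hper ha)) hd (fun i => by rw [hper]) H
  suffices h : m = d from h ▸ hsimple 0
  by_contra hne
  refine c.not_isPrimitiveCycle he hd hmd hne (fun i => ?_) hp
  obtain ⟨h1, h2⟩ := Prod.mk.inj (hm i)
  exact Prod.ext (hc _ _ h1) h2

end Winding

/-! ### Nice sequences that cannot be refined -/

namespace Winding

open FinQuiver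

variable {S : FinQuiver.{u, v}} {Q : FinQuiver.{u', v'}} (c : Winding S Q)

theorem niceLength_lt_top_iff : c.niceLength < ⊤ ↔ ∃ n, c.DistinguishedBy n := by
  simp only [niceLength, iInf_lt_iff]
  exact ⟨fun ⟨n, h, _⟩ => ⟨n, h⟩, fun ⟨n, h⟩ => ⟨n, h, WithTop.coe_lt_top n⟩⟩

/-- The quotient of the source of a winding by the fibres of a map `κ` on its vertices: two arrows
are identified if they have the same image under the winding and if their end points are
identified. -/
def quotient {K : Type w} (κ : S.V → K) : FinQuiver.{w, max v' w} where
  V := Set.range κ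
  A := Set.range fun b => (c.onA b, κ (S.src b), κ (S.tgt b))
  src a := ⟨a.1.2.1, by
    obtain ⟨_, b, rfl⟩ := a
    exact ⟨_, rfl⟩⟩
  tgt a := ⟨a.1.2.2, by
    obtain ⟨_, b, rfl⟩ := a
    exact ⟨_, rfl⟩⟩
  finite_V := by
    have := S.finite_V
    exact Set.finite_range κ
  finite_A := by
    have := S.finite_A
    exact Set.finite_range _

/-- The projection onto the quotient. It is a winding, since it factors the given one on
arrows. -/
def toQuotient {K : Type w} (κ : S.V → K) : Winding S (c.quotient κ) where
  onV x := ⟨κ x, x, rfl⟩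
  onA b := ⟨_, b, rfl⟩
  src_onA _ := rfl
  tgt_onA _ := rfl
  inj_src a b hne hs h := c.inj_src a b hne hs (congrArg (fun z => z.1.1) h)
  inj_tgt a b hne ht h := c.inj_tgt a b hne ht (congrArg (fun z => z.1.1) h)

/-- `κ` cannot be refined: every function on the vertices whose differences along arrows depend
only on the image of the arrow in the quotient by `κ` is constant on the fibres of `κ`. -/
def IsStable {K : Type w} (κ : S.V → K) : Prop :=
  ∀ (W : (c.quotient κ).A → ℤ) (g : S.V → ℤ),
    (∀ b, g (S.tgt b) - g (S.src b) = W ((c.toQuotient κ).onA b)) →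
    ∀ x y, κ x = κ y → g x = g y

/-- A nice sequence with as few inseparable pairs of vertices as possible cannot be refined. So it
suffices that all unrefinable maps are injective. -/
theorem niceLength_lt_top_of_isStable
    (h : ∀ (n : ℕ) (κ : S.V → Fin n → ℤ), c.IsStable κ → Function.Injective κ) :
    c.niceLength < ⊤ := by
  classical
  have := S.finite_V
  let P (n : ℕ) (δ : ℕ → S.V → ℤ) : Set (S.V × S.V) := {z | ∀ j < n, δ j z.1 = δ j z.2}
  have hex : ∃ k n δ, c.IsNiceSequence δ ∧ (P n δ).ncard = k :=
    ⟨_, 0, fun _ _ => 0, fun i b b' _ _ _ => rfl, rfl⟩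
  obtain ⟨n, δ, hδ, hk⟩ := Nat.find_spec hex
  have hmin := fun {k} => Nat.find_min hex (m := k)
  rw [← hk] at hmin
  have hinj := h n (fun x j => δ j x) fun W g hg x y hxy => by
    by_contra hne
    let δ' : ℕ → S.V → ℤ := fun j => if j < n then δ j else if j = n then g else fun _ => 0
    have h1 : ∀ j < n, δ' j = δ j := fun j hj => if_pos hj
    have h2 : δ' n = g := by simp [δ']
    have h3 : ∀ j, n < j → δ' j = fun _ => 0 := fun j hj => by
      simp [δ', hj.not_gt, hj.ne']
    refine hmin (k := (P (n + 1) δ').ncard) (Set.ncard_lt_ncard ?_ (Set.toFinite _))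
      ⟨n + 1, δ', fun i b b' hs ht hb => ?_, rfl⟩
    · refine ⟨fun z hz j hj => ?_, fun hsub => hne ?_⟩
      · have := hz j (by omega)
        rwa [h1 j hj] at this
      · have := hsub (a := (x, y)) (fun j hj => congrFun hxy ⟨j, hj⟩) n (by omega)
        rwa [h2] at this
    · replace hs : ∀ j : Fin i, δ' j (S.src b) = δ' j (S.src b') := hs
      replace ht : ∀ j : Fin i, δ' j (S.tgt b) = δ' j (S.tgt b') := ht
      rcases lt_trichotomy i n with hi | rfl | hi
      · rw [h1 i hi]
        refine hδ i b b' (fun j => ?_) (fun j => ?_) hb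
        · have := hs j
          rw [h1 j (by omega)] at this
          exact this
        · have := ht j
          rw [h1 j (by omega)] at this
          exact this
      · rw [h2, hg, hg]
        congr 1
        refine Subtype.ext (Prod.ext hb (Prod.ext (funext fun j => ?_) (funext fun j => ?_)))
        · have := hs j
          rw [h1 j j.2] at this
          exact this
        · have := ht j
          rw [h1 j j.2] at this
          exact this
      · rw [h3 i hi]
  refine c.niceLength_lt_top_iff.mpr ⟨n, δ, hδ, fun x y hxy => ?_⟩
  obtain ⟨j, hj⟩ := Function.ne_iff.mp (hinj.ne hxy)
  exact ⟨j, j.2.le, hj⟩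

/-- Along a cycle whose word has a proper period, the functions of a nice sequence have this
period: their differences along one period are constant and add up to zero over the cycle. -/
theorem nice_eq_of_period {e : ℕ → S.SignedArrow} (he : S.IsInfiniteWalk e) {m k : ℕ}
    (hk : 0 < k) (hper : ∀ i, e (i + k * m) = e i)
    (hm : ∀ i, c.letter (e (i + m)) = c.letter (e i)) (δ : ℕ → S.V → ℤ)
    (hδ : ∀ j i i', (∀ l < j, δ l (S.src (e i).1) = δ l (S.src (e i').1)) →
      (∀ l < j, δ l (S.tgt (e i).1) = δ l (S.tgt (e i').1)) →
      c.onA (e i).1 = c.onA (e i').1 →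
      δ j (S.tgt (e i).1) - δ j (S.src (e i).1) = δ j (S.tgt (e i').1) - δ j (S.src (e i').1))
    (j i : ℕ) : δ j (S.start (e (i + m))) = δ j (S.start (e i)) := by
  induction j using Nat.strong_induction_on generalizing i with
  | _ j ih =>
    have hdiff : ∀ i, δ j (S.start (e (i + 1 + m))) - δ j (S.start (e (i + m))) =
        δ j (S.start (e (i + 1))) - δ j (S.start (e i)) := by
      intro i
      obtain ⟨h1, h2⟩ := Prod.mk.inj (hm i)
      have hs : ∀ l < j, δ l (S.start (e (i + m))) = δ l (S.start (e i)) := fun l hl => ih l hl i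
      have ht : ∀ l < j, δ l (S.finish (e (i + m))) = δ l (S.finish (e i)) := fun l hl => by
        rw [he, he, add_right_comm]
        exact ih l hl (i + 1)
      have hd := hδ j (i + m) i
      rw [add_right_comm, ← he (i + m), ← he i]
      rcases hei : e i with ⟨a, s⟩
      rcases hei' : e (i + m) with ⟨a', s'⟩
      rw [hei, hei'] at hd hs ht
      obtain rfl : s' = s := by rw [hei, hei'] at h2; exact h2
      rw [hei, hei'] at h1
      cases s'
      · have := hd ht hs h1
        simp only [start, finish]
        simp only at this
        linarith
      · exact hd hs ht h1
    have hconst : ∀ i, δ j (S.start (e (i + m))) - δ j (S.start (e i)) =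
        δ j (S.start (e (0 + m))) - δ j (S.start (e 0)) := by
      intro i
      induction i with
      | zero => rfl
      | succ i ih' => linarith [hdiff i]
    have hsum : ∀ r i, δ j (S.start (e (i + r * m))) - δ j (S.start (e i)) =
        r * (δ j (S.start (e (0 + m))) - δ j (S.start (e 0))) := by
      intro r i
      induction r with
      | zero => simp
      | succ r ih' =>
        have := hconst (i + r * m)
        rw [add_mul, one_mul, ← add_assoc]
        push_cast
        linarith
    have h0 := hsum k i
    rw [hper, sub_self, eq_comm, mul_eq_zero, or_iff_right (by exact_mod_cast hk.ne')] at h0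
    linarith [hconst i]

/-- If some cycle is not primitive, then no nice sequence separates its vertices. Only the arrows of
the cycle need to satisfy the condition on nice sequences. -/
theorem exists_inseparable_of_not_isPrimitiveCycle {p : List S.SignedArrow} (hp : S.IsCycle p)
    (hprim : ¬ c.IsPrimitiveCycle p) (δ : ℕ → S.V → ℤ)
    (hδ : ∀ j, ∀ b ∈ p.map Prod.fst, ∀ b' ∈ p.map Prod.fst,
      (∀ l < j, δ l (S.src b) = δ l (S.src b')) → (∀ l < j, δ l (S.tgt b) = δ l (S.tgt b')) →
      c.onA b = c.onA b' → δ j (S.tgt b) - δ j (S.src b) = δ j (S.tgt b') - δ j (S.src b')) :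
    ∃ f ∈ p, ∃ f' ∈ p, S.start f ≠ S.start f' ∧ ∀ j, δ j (S.start f) = δ j (S.start f') := by
  obtain ⟨e, he, hper, hseg, hd, hs, -⟩ := hp.exists_infiniteWalk
  generalize p.length = d at *
  subst hseg
  obtain ⟨m, k, hm0, hk, rfl, hm⟩ := c.exists_period_of_not_isPrimitiveCycle hd hper hprim
  have hmem : ∀ i, e i ∈ steps e 0 (k * m) := fun i => by
    rw [← eq_mod_of_periodic hper i, steps]
    refine List.mem_map_of_mem ?_
    rw [List.mem_range'_1]
    have := Nat.mod_lt i hd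
    omega
  refine ⟨_, hmem (0 + m), _, hmem 0, fun h => ?_, fun j => ?_⟩
  · have := hs _ _ h
    rw [zero_add, Nat.zero_mod, Nat.mod_eq_of_lt (by nlinarith)] at this
    omega
  · exact c.nice_eq_of_period he (by omega) hper hm δ (fun j i i' => hδ j _
      (List.mem_map_of_mem (hmem i)) _ (List.mem_map_of_mem (hmem i'))) j 0

theorem isPrimitiveCycle_of_niceLength_lt_top (h : c.niceLength < ⊤) {p : List S.SignedArrow}
    (hp : S.IsCycle p) : c.IsPrimitiveCycle p := by
  obtain ⟨n, δ, hδ, hsep⟩ := c.niceLength_lt_top_iff.mp h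
  by_contra hprim
  obtain ⟨f, -, f', -, hne, heq⟩ := c.exists_inseparable_of_not_isPrimitiveCycle hp hprim δ
    fun j b _ b' _ h1 h2 h3 => hδ j b b' (fun l => h1 l l.2) (fun l => h2 l l.2) h3
  obtain ⟨i, -, hi⟩ := hsep _ _ hne
  exact hi (heq i)

end Winding

/-! ### Trees, cycles and pseudotrees -/

namespace Winding

open FinQuiver

variable {S : FinQuiver.{u, v}} {Q : FinQuiver.{u', v'}} (c : Winding S Q)

/-- In a tree every weight has a potential. If an unrefinable map identified two vertices, then some
walk between such vertices would become a cycle in the quotient, and the indicator of one arrow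
of this cycle would have a potential that tells them apart. -/
theorem niceLength_lt_top_of_isTree (hS : S.IsTree) : c.niceLength < ⊤ := by
  classical
  refine c.niceLength_lt_top_of_isStable fun n κ hκ x y hxy => ?_
  by_contra hne
  obtain ⟨p, hp⟩ := hS.1.2 x y
  obtain ⟨x', y', p', hp', -, hc', hcyc, -⟩ :=
    (c.toQuotient κ).exists_walk_isCycle hp hne (Subtype.ext hxy)
  obtain ⟨f, hf⟩ := List.exists_mem_of_ne_nil _ hcyc.1.1
  let W : (c.quotient κ).A → ℤ := Pi.single f.1 1
  obtain ⟨g, hg⟩ := hS.1.exists_potential (fun b => W ((c.toQuotient κ).onA b)) fun x q hq => by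
    rw [chain_eq_zero_of_acyclic hS.2 hq, map_zero]
  have h1 := linearCombination_chain hg hp'
  rw [← linearCombination_mapWalk, linearCombination_indicator,
    hκ W g hg x' y' (congrArg Subtype.val hc'), sub_self] at h1
  exact (chain_apply_ne_zero_iff hcyc.2.2).mpr (List.mem_map_of_mem hf) h1

/-- A weight on a quiver of type `Ã_n` has a potential if it vanishes on the cycle. -/
theorem _root_.FinQuiver.IsCyclePresentation.exists_potential {p : List S.SignedArrow}
    (hp : S.IsCyclePresentation p) (W : S.A → ℤ)
    (hW : Finsupp.linearCombination ℤ W (S.chain p) = 0) :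
    ∃ g : S.V → ℤ, ∀ b, g (S.tgt b) - g (S.src b) = W b := by
  obtain ⟨hcyc, hV, hA⟩ := hp
  obtain ⟨e, he, hper, hseg, hd, hs, -⟩ := hcyc.exists_infiniteWalk
  generalize p.length = d at *
  subst hseg
  -- the potential along the infinite walk
  let G : ℕ → ℤ := fun i => Finsupp.linearCombination ℤ W (S.chain (steps e 0 i))
  have hadd : ∀ m n, G (m + n) = G m + Finsupp.linearCombination ℤ W (S.chain (steps e m n)) := by
    intro m n
    simp only [G]
    rw [← map_add, ← chain_append, steps, steps, steps, ← List.map_append]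
    congr 4
    simpa using (List.range'_append_1 (s := 0) (m := m) (n := n)).symm
  have hGper : ∀ i, G (i + d) = G i := by
    intro i
    have : steps e d i = steps e 0 i := by
      simp only [steps, List.range'_eq_map_range, List.map_map]
      refine List.map_congr_left fun j _ => ?_
      simp only [Function.comp]
      rw [zero_add, add_comm, hper]
    rw [add_comm i d, hadd, this]
    simp [G, hW]
  have hidx : ∀ x, ∃ i, S.start (e i) = x := by
    intro x
    obtain ⟨f, hf, rfl⟩ := List.mem_map.mp (hV x)
    obtain ⟨i, -, rfl⟩ := List.mem_map.mp hf
    exact ⟨i, rfl⟩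
  choose idx hidx using hidx
  have hg : ∀ i, G (idx (S.start (e i))) = G i := by
    intro i
    have := hs _ _ (hidx (S.start (e i)))
    rw [← eq_mod_of_periodic hGper, this, eq_mod_of_periodic hGper]
  refine ⟨fun x => G (idx x), fun b => ?_⟩
  obtain ⟨i, -, -, rfl⟩ := mem_steps.mp (hA b)
  have h1 := hg i
  have h2 := hg (i + 1)
  rw [hadd] at h2
  rw [← he] at h2
  rcases hei : e i with ⟨a, s⟩
  rw [hei] at h1 h2
  simp only [steps, List.range'_one, List.map_cons, List.map_nil, hei, chain, add_zero,
    Finsupp.linearCombination_single] at h2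
  cases s
  · simp only [start, finish] at h1 h2
    simp only [h1, h2]
    simp
  · simp only [start, finish] at h1 h2
    simp only [h1, h2]
    simp

/-- If an unrefinable map identifies two vertices of a cycle, then the chain of the walk between them
is proportional to the chain of the cycle. Hence all simple closed segments of the image of the
cycle in the quotient run through the same arrows. -/
theorem niceLength_lt_top_of_isCyclePresentation {p : List S.SignedArrow}
    (hp : S.IsCyclePresentation p) (hprim : c.IsPrimitiveCycle p) : c.niceLength < ⊤ := by
  refine c.niceLength_lt_top_of_isStable fun n κ hκ => ?_
  have hpot := hp.exists_potential
  obtain ⟨hcyc, hV, hA⟩ := hp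
  obtain ⟨e, he, hper, hseg, hd, -, ha⟩ := hcyc.exists_infiniteWalk
  generalize p.length = d at *
  subst hseg
  set c' := c.toQuotient κ with hc'
  have hL := c'.isInfiniteWalk_letter he
  have hred := c'.isReduced_letter he (isReduced_of_cycle hper ha)
  have hsupp : ∀ s n, IsSimpleSegment (fun i => c'.letter (e i)) s n → ∀ a,
      a ∈ (steps (fun i => c'.letter (e i)) s n).map Prod.fst ↔
        (c.quotient κ).chain (c'.mapWalk (steps e 0 d)) a ≠ 0 := by
    intro s n hsn a
    have hnd := hsn.nodup_arrows hL hred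
    obtain ⟨m, l, hm, hml⟩ := exists_smul_eq_smul
      ((c.quotient κ).chain (steps (fun i => c'.letter (e i)) s n))
      ((c.quotient κ).chain (c'.mapWalk (steps e 0 d))) fun W hW => by
        rw [linearCombination_mapWalk] at hW
        obtain ⟨g, hg⟩ := hpot _ hW
        rw [← mapWalk_steps, linearCombination_mapWalk,
          linearCombination_chain hg (he.isWalk_steps s n), sub_eq_zero]
        refine hκ W g hg _ _ (congrArg Subtype.val (?_ : c'.onV _ = c'.onV _))
        rw [← start_letter, ← start_letter]
        exact hsn.2.1
    have hml' : ∀ a, m * (c.quotient κ).chain (steps (fun i => c'.letter (e i)) s n) a =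
        l * (c.quotient κ).chain (c'.mapWalk (steps e 0 d)) a := fun a => by
      simpa using DFunLike.congr_fun hml a
    have hl : l ≠ 0 := by
      rintro rfl
      obtain ⟨f, hf⟩ := List.exists_mem_of_ne_nil _
        (steps_ne_nil (L := fun i => c'.letter (e i)) (s := s) hsn.1)
      have h1 := (chain_apply_ne_zero_iff hnd).mpr (List.mem_map_of_mem hf)
      have h2 := hml' f.1
      rw [zero_mul] at h2
      exact h1 ((mul_eq_zero.mp h2).resolve_left hm)
    rw [← chain_apply_ne_zero_iff hnd, ← mul_ne_zero_iff_left hm, hml', mul_ne_zero_iff_left hl]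
  have hsimple := isSimpleSegment_of_isPrimitiveCycle he hd hper ha (c := c) (c' := c')
    (fun b b' h => congrArg (fun z => z.1.1) h) hprim fun s n s' n' h h' a =>
      ((hsupp s n h a).trans (hsupp s' n' h' a).symm).mp
  have hlt : ∀ i j, i < j → j < d → κ (S.start (e i)) ≠ κ (S.start (e j)) := by
    intro i j hij hj h
    refine hsimple.2.2 i j (Nat.zero_le _) hij (by omega) ?_
    simp only [start_letter]
    exact Subtype.ext h
  intro x y hxy
  obtain ⟨f, hf, rfl⟩ := List.mem_map.mp (hV x)
  obtain ⟨f', hf', rfl⟩ := List.mem_map.mp (hV y)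
  obtain ⟨i, hi, rfl⟩ := List.mem_map.mp hf
  obtain ⟨j, hj, rfl⟩ := List.mem_map.mp hf'
  rw [List.mem_range'_1] at hi hj
  rcases lt_trichotomy i j with h | rfl | h
  · exact absurd hxy (hlt i j h (by omega))
  · rfl
  · exact absurd hxy.symm (hlt j i h (by omega))

/-- Any two vertices of a closed walk are joined by a walk along its arrows. -/
theorem _root_.FinQuiver.exists_walk_of_mem {x y z : S.V} {p : List S.SignedArrow}
    (hp : S.IsWalk x p x) (hy : y ∈ p.map S.start) (hz : z ∈ p.map S.start) :
    ∃ r, S.IsWalk y r z ∧ r ⊆ p := by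
  obtain ⟨f, hf, rfl⟩ := List.mem_map.mp hy
  obtain ⟨f', hf', rfl⟩ := List.mem_map.mp hz
  obtain ⟨a, b, hab⟩ := List.append_of_mem hf
  obtain ⟨a', b', hab'⟩ := List.append_of_mem hf'
  obtain ⟨_, -, rfl, h1⟩ := isWalk_append.mp (hab ▸ hp)
  obtain ⟨_, h2, rfl, -⟩ := isWalk_append.mp (hab' ▸ hp)
  refine ⟨(f :: b) ++ a', isWalk_append.mpr ⟨x, ⟨rfl, h1⟩, h2⟩, fun g hg => ?_⟩
  rcases List.mem_append.mp hg with h | h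
  · rw [hab]
    exact List.mem_append_right _ h
  · rw [hab']
    exact List.mem_append_left _ h

/-- Over a pseudotree, the hypothesis of `FinQuiver.exists_period_isSimpleSegment` holds. -/
theorem _root_.FinQuiver.IsPseudotree.mem_steps_of_isSimpleSegment (hQ : Q.IsPseudotree)
    {L : ℕ → Q.SignedArrow} (hL : Q.IsInfiniteWalk L) (hred : IsReduced L) (s n s' n' : ℕ)
    (h : IsSimpleSegment L s n) (h' : IsSimpleSegment L s' n') (a : Q.A)
    (ha : a ∈ (steps L s n).map Prod.fst) : a ∈ (steps L s' n').map Prod.fst := by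
  have h1 := hL.isWalk_steps s n
  have h2 := hL.isWalk_steps s' n'
  rw [h.2.1] at h1
  rw [h'.2.1] at h2
  exact hQ.mem_arrows h1 h2 (h.nodup_arrows hL hred) (h'.nodup_arrows hL hred)
    (steps_ne_nil h'.1) ha

/-- Over a pseudotree, a winding that maps some cycle to a cycle is injective on vertices: what is
attached to the cycle of the source maps to the trees that are attached to the cycle of the
pseudotree. -/
theorem onV_injective_of_isCycle_mapWalk (hQ : Q.IsPseudotree) (hS : S.Connected)
    {p : List S.SignedArrow} (hp : S.IsCycle p) (hpQ : Q.IsCycle (c.mapWalk p)) :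
    Function.Injective c.onV := by
  classical
  obtain ⟨⟨hp0, x₀, hx₀⟩, -, -⟩ := hp
  obtain ⟨⟨hq0, -⟩, hqs, hqa⟩ := hpQ
  have hq := c.isWalk_mapWalk hx₀
  have hmap : (c.mapWalk p).map Q.start = (p.map S.start).map c.onV := by
    simp only [mapWalk, List.map_map]
    exact List.map_congr_left fun e _ => c.start_letter e
  set P := p.map S.start with hP
  rw [hmap] at hqs
  have hPinj : ∀ z ∈ P, ∀ z' ∈ P, c.onV z = c.onV z' → z = z' := by
    intro z hz z' hz' h
    exact List.inj_on_of_nodup_map hqs hz hz' h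
  have hPfin : ∀ e ∈ p, S.finish e ∈ P := by
    intro e he
    obtain ⟨a, b, hab⟩ := List.append_of_mem he
    obtain ⟨y, h1, rfl, h2⟩ := isWalk_append.mp (hab ▸ hx₀)
    rcases b with _ | ⟨f, b⟩
    · rw [show S.finish e = x₀ from h2]
      rcases p with _ | ⟨f, p⟩
      · exact absurd rfl hp0
      · rw [← hx₀.1]
        simp [hP]
    · rw [← h2.1, hP, hab]
      simp
  have hCV : ∀ f : Q.SignedArrow, f.1 ∈ (c.mapWalk p).map Prod.fst → Q.start f ∈ P.map c.onV := by
    intro f hf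
    obtain ⟨f', hf', hff'⟩ := List.mem_map.mp hf
    obtain ⟨e, he, rfl⟩ := List.mem_map.mp hf'
    rcases eq_or_eq_not hff' with h | h
    · rw [h]
      exact List.mem_map.mpr ⟨_, List.mem_map_of_mem he, (c.start_letter e).symm⟩
    · rw [h, start_not]
      exact List.mem_map.mpr ⟨_, hPfin e he, (c.finish_letter e).symm⟩
  -- arrows over the cycle that touch `p` belong to `p`
  have hPA : ∀ e : S.SignedArrow, S.start e ∈ P → c.onA e.1 ∈ (c.mapWalk p).map Prod.fst →
      S.finish e ∈ P := by
    intro e hs ha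
    obtain ⟨f', hf', hff'⟩ := List.mem_map.mp ha
    obtain ⟨e', he', rfl⟩ := List.mem_map.mp hf'
    have hle : (c.letter e').1 = (c.letter e).1 := hff'
    rcases eq_or_eq_not hle with h | h
    · have hst := congrArg Q.start h
      rw [start_letter, start_letter] at hst
      rw [c.letter_injective (hPinj _ hs _ (List.mem_map_of_mem he') hst) h]
      exact hPfin _ he'
    · have hst := congrArg Q.start h
      rw [start_not, start_letter, finish_letter] at hst
      have : e = (e'.1, !e'.2) := by
        refine c.letter_injective ?_ h
        rw [start_not]
        exact hPinj _ hs _ (hPfin _ he') hst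
      rw [this, finish_not]
      exact List.mem_map_of_mem he'
  -- all vertices over the cycle belong to `p`
  have hover : ∀ x, c.onV x ∈ P.map c.onV → x ∈ P := by
    by_contra! hcon
    obtain ⟨x₁, hx₁, hx₁P⟩ := hcon
    have hx₀P : x₀ ∈ P := by
      rcases p with _ | ⟨f, p⟩
      · exact absurd rfl hp0
      · rw [← hx₀.1]
        simp [hP]
    -- a shortest walk from `p` to a vertex over the cycle that is not in `p`
    have hex : ∃ n z x r, z ∈ P ∧ x ∉ P ∧ c.onV x ∈ P.map c.onV ∧ S.IsWalk z r x ∧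
        r.length = n := by
      obtain ⟨r, hr⟩ := hS.2 x₀ x₁
      exact ⟨_, x₀, x₁, r, hx₀P, hx₁P, hx₁, hr, rfl⟩
    obtain ⟨z, x, r, hz, hx, hxC, hr, hn⟩ := Nat.find_spec hex
    have hmin := fun {k} => Nat.find_min hex (m := k)
    rw [← hn] at hmin
    have hoff : ∀ f ∈ r, c.onA f.1 ∉ (c.mapWalk p).map Prod.fst := by
      intro f hf hfC
      obtain ⟨a, b, rfl⟩ := List.append_of_mem hf
      obtain ⟨_, h1, rfl, h2⟩ := isWalk_append.mp hr
      by_cases hfP : S.start f ∈ P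
      · exact hmin (k := b.length) (by simp; omega)
          ⟨_, x, b, hPA f hfP hfC, hx, hxC, h2, rfl⟩
      · refine hmin (k := a.length) (by simp) ⟨z, _, a, hz, hfP, ?_, h1, rfl⟩
        rw [← start_letter]
        exact hCV _ hfC
    have hzC : c.onV z ∈ P.map c.onV := List.mem_map_of_mem hz
    have hcr := c.isWalk_mapWalk hr
    by_cases hzx : c.onV z = c.onV x
    · obtain ⟨x', y', r', hr', -, hxy', hcyc, hsub⟩ := c.exists_walk_isCycle hr
        (fun h => hx (h ▸ hz)) hzx
      obtain ⟨f, hf⟩ := List.exists_mem_of_ne_nil _ hcyc.1.1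
      obtain ⟨f', hf', rfl⟩ := List.mem_map.mp hf
      have hcl := c.isWalk_mapWalk hr'
      rw [← hxy'] at hcl
      exact hoff f' (hsub hf') (hQ.mem_arrows hcl hq hcyc.2.2 hqa hq0 (List.mem_map_of_mem hf))
    · -- closed up along the cycle, the image of `r` has a chain that is proportional to the cycle
      obtain ⟨t, ht, htp⟩ := FinQuiver.exists_walk_of_mem hq (hmap ▸ hxC) (hmap ▸ hzC)
      have hcl := isWalk_append.mpr ⟨_, hcr, ht⟩
      obtain ⟨m, n, hm, hchain⟩ := hQ.exists_smul_chain_eq hcl hq hqa hq0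
      have hzero : Q.chain (c.mapWalk r) = 0 := by
        ext a
        by_cases haC : a ∈ (c.mapWalk p).map Prod.fst
        · refine chain_apply_eq_zero fun har => ?_
          obtain ⟨f, hf, rfl⟩ := List.mem_map.mp har
          obtain ⟨f', hf', rfl⟩ := List.mem_map.mp hf
          exact hoff f' hf' haC
        · have h2 := DFunLike.congr_fun hchain a
          rw [chain_append, Finsupp.smul_apply, Finsupp.smul_apply, Finsupp.add_apply,
            chain_apply_eq_zero haC, chain_apply_eq_zero (p := t), add_zero, smul_zero,
            smul_eq_mul] at h2
          · exact (mul_eq_zero.mp h2).resolve_left hm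
          · intro hat
            obtain ⟨f, hf, rfl⟩ := List.mem_map.mp hat
            exact haC (List.mem_map_of_mem (htp hf))
      have hb := boundary_chain hcr
      rw [hzero, map_zero, eq_comm, sub_eq_zero] at hb
      exact hzx (Finsupp.single_left_injective one_ne_zero hb).symm
  intro x y hxy
  by_contra hne
  obtain ⟨r, hr⟩ := hS.2 x y
  obtain ⟨x', y', r', hr', hne', hxy', hcyc, -⟩ := c.exists_walk_isCycle hr hne hxy
  have hcl := c.isWalk_mapWalk hr'
  rw [← hxy'] at hcl
  have hx'C : c.onV x' ∈ P.map c.onV := by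
    rcases r' with _ | ⟨f, r'⟩
    · exact absurd hr' hne'
    · rw [← hr'.1, ← start_letter]
      exact hCV _ (hQ.mem_arrows hcl hq hcyc.2.2 hqa hq0 (by simp [mapWalk, letter]))
  exact hne' (hPinj _ (hover _ hx'C) _ (hover _ (hxy' ▸ hx'C)) hxy')

/-- Over a pseudotree, the image of a primitive cycle is a cycle. -/
theorem isCycle_mapWalk_of_isPrimitiveCycle (hQ : Q.IsPseudotree) {p : List S.SignedArrow}
    (hp : S.IsCycle p) (hprim : c.IsPrimitiveCycle p) : Q.IsCycle (c.mapWalk p) := by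
  obtain ⟨e, he, hper, hseg, hd, -, ha⟩ := hp.exists_infiniteWalk
  generalize p.length = d at *
  subst hseg
  have hL := c.isInfiniteWalk_letter he
  have hred := c.isReduced_letter he (isReduced_of_cycle hper ha)
  have hsimple := isSimpleSegment_of_isPrimitiveCycle he hd hper ha (c := c) (c' := c)
    (fun _ _ h => h) hprim (hQ.mem_steps_of_isSimpleSegment hL hred)
  rw [mapWalk_steps]
  have hw := hL.isWalk_steps 0 d
  rw [hsimple.2.1] at hw
  refine ⟨⟨steps_ne_nil hd, _, hw⟩, ?_, hsimple.nodup_arrows hL hred⟩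
  rw [steps, List.map_map]
  refine List.Nodup.map_on (fun i hi j hj h => ?_) (List.nodup_range' ..)
  rw [List.mem_range'_1] at hi hj
  rcases lt_trichotomy i j with hij | hij | hij
  · exact absurd h (hsimple.2.2 i j hi.1 hij hj.2)
  · exact hij
  · exact absurd h.symm (hsimple.2.2 j i hj.1 hij hi.2)

/-- A primitive cycle makes the winding injective on vertices, so that the weights on the arrows of
the pseudotree that vanish on its cycle separate all vertices. -/
theorem niceLength_lt_top_of_isPseudotree (hQ : Q.IsPseudotree) (hS : S.Connected)
    {p : List S.SignedArrow} (hp : S.IsCycle p) (hprim : c.IsPrimitiveCycle p) :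
    c.niceLength < ⊤ := by
  have hpQ := c.isCycle_mapWalk_of_isPrimitiveCycle hQ hp hprim
  have hinj := c.onV_injective_of_isCycle_mapWalk hQ hS hp hpQ
  obtain ⟨⟨hq0, x₀, hq⟩, -, hqa⟩ := hpQ
  refine c.niceLength_lt_top_of_isStable fun n κ hκ x y hxy => by_contra fun hne => ?_
  obtain ⟨r, hr⟩ := hS.2 x y
  have hcr := boundary_chain (c.isWalk_mapWalk hr)
  obtain ⟨m, l, hm, hml⟩ := exists_smul_eq_smul (Q.chain (c.mapWalk r)) (Q.chain (c.mapWalk p))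
    fun W hW => by
      obtain ⟨g, hg⟩ := hS.exists_potential (fun b => W (c.onA b)) fun z t ht => by
        rw [← linearCombination_mapWalk]
        obtain ⟨m, n, hm, h⟩ :=
          hQ.exists_smul_chain_eq (c.isWalk_mapWalk ht) hq hqa hq0
        have := congrArg (Finsupp.linearCombination ℤ W) h
        rw [map_smul, map_smul, hW, smul_zero, smul_eq_mul] at this
        exact (mul_eq_zero.mp this).resolve_left hm
      rw [linearCombination_mapWalk, linearCombination_chain hg hr, sub_eq_zero]
      exact (hκ (fun a => W a.1.1) g hg x y hxy).symm
  have hb := congrArg Q.boundary hml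
  rw [map_smul, map_smul, hcr, boundary_chain hq, sub_self, smul_zero, smul_eq_zero,
    or_iff_right hm, sub_eq_zero] at hb
  exact hne (hinj (Finsupp.single_left_injective one_ne_zero hb).symm)

/-- Over a pseudotree, a cycle maps to the arrows of the cycle of the pseudotree. -/
theorem onA_mem_of_isCycle (hQ : Q.IsPseudotree) {p : List S.SignedArrow} (hp : S.IsCycle p)
    {q : List Q.SignedArrow} (hq : Q.IsCycle q) {b : S.A} (hb : b ∈ p.map Prod.fst) :
    c.onA b ∈ q.map Prod.fst := by
  obtain ⟨e, he, hper, hseg, hd, -, ha⟩ := hp.exists_infiniteWalk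
  generalize p.length = d at *
  subst hseg
  have hL := c.isInfiniteWalk_letter he
  have hred := c.isReduced_letter he (isReduced_of_cycle hper ha)
  obtain ⟨m, -, -, hsimple⟩ := exists_period_isSimpleSegment hL hred hd (fun i => by rw [hper])
    (hQ.mem_steps_of_isSimpleSegment hL hred)
  obtain ⟨i, -, -, rfl⟩ := mem_steps.mp hb
  have hi := hsimple i
  obtain ⟨⟨hq0, y, hqw⟩, -, hqa⟩ := hq
  have hw := hL.isWalk_steps i m
  rw [hi.2.1] at hw
  exact hQ.mem_arrows hw hqw (hi.nodup_arrows hL hred) hqa hq0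
    (mem_steps.mpr ⟨i, le_rfl, by have := hi.1; omega, rfl⟩)

end Winding

/-! ### Coefficient quivers -/

namespace F1Rep

open FinQuiver

variable {Q : FinQuiver.{u, v}} (M : F1Rep.{u, v, w} Q)

/-- The vertices that can be reached from a given one span a subrepresentation, and so do the
others. -/
theorem connected_coeffQuiver (hM : M.IsIndecomposable) : M.coeffQuiver.Connected := by
  obtain ⟨⟨i₀, z₀, hz₀⟩, hind⟩ := hM
  refine ⟨⟨⟨i₀, z₀, hz₀⟩⟩, fun x y => ?_⟩
  let R (i : Q.V) (z : M.X i) : Prop := ∃ h : z ≠ 0, ∃ p, M.coeffQuiver.IsWalk x p ⟨i, z, h⟩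
  have hstep : ∀ a (z : M.X (Q.src a)), M.f a z ≠ 0 → (R _ z ↔ R _ (M.f a z)) := by
    intro a z hz
    have hz' := M.ne_zero_of_map_ne_zero a hz
    have h1 : M.coeffQuiver.IsWalk ⟨_, z, hz'⟩ [(⟨a, z, hz⟩, true)] ⟨_, M.f a z, hz⟩ := ⟨rfl, rfl⟩
    have h2 : M.coeffQuiver.IsWalk ⟨_, M.f a z, hz⟩ [(⟨a, z, hz⟩, false)] ⟨_, z, hz'⟩ := ⟨rfl, rfl⟩
    exact ⟨fun ⟨h, p, hp⟩ => ⟨hz, _, isWalk_append.mpr ⟨_, hp, h1⟩⟩,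
      fun ⟨h, p, hp⟩ => ⟨hz', _, isWalk_append.mpr ⟨_, hp, h2⟩⟩⟩
  have hR : M.IsSubrep fun i => {z | z = 0 ∨ R i z} := by
    refine ⟨fun i => Or.inl rfl, fun a z hz => or_iff_not_imp_left.mpr fun h0 => ?_⟩
    exact (hstep a z h0).mp (hz.resolve_left (M.ne_zero_of_map_ne_zero a h0))
  have hR' : M.IsSubrep fun i => {z | z = 0 ∨ ¬ R i z} := by
    refine ⟨fun i => Or.inl rfl, fun a z hz => or_iff_not_imp_left.mpr fun h0 h => ?_⟩
    exact hz.resolve_left (M.ne_zero_of_map_ne_zero a h0) ((hstep a z h0).mpr h)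
  rcases hind _ _ hR hR' (fun i => by ext z; simp; tauto)
    (fun i => by ext z; simp [← or_and_left])
    with h | h
  · have : x.2.1 ∈ ({0} : Set (M.X x.1)) := h x.1 ▸ Or.inr ⟨x.2.2, [], rfl⟩
    exact absurd this x.2.2
  · by_contra hy
    have : y.2.1 ∈ ({0} : Set (M.X y.1)) := h y.1 ▸ Or.inr fun ⟨_, hp⟩ => hy hp
    exact absurd this y.2.2

/-- The inclusion of a subquiver. -/
def _root_.FinQuiver.Subquiver.inclusion (C : Q.Subquiver) : Winding C.toFinQuiver Q where
  onV := Subtype.val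
  onA := Subtype.val
  src_onA _ := rfl
  tgt_onA _ := rfl
  inj_src _ _ hne _ h := hne (Subtype.ext h)
  inj_tgt _ _ hne _ h := hne (Subtype.ext h)

theorem _root_.FinQuiver.Subquiver.isCycle_inclusion {C : Q.Subquiver}
    {q : List C.toFinQuiver.SignedArrow} (hq : C.toFinQuiver.IsCycle q) :
    Q.IsCycle (C.inclusion.mapWalk q) := by
  obtain ⟨⟨hq0, x, hx⟩, hs, ha⟩ := hq
  refine ⟨⟨by simpa [Winding.mapWalk] using hq0, _, C.inclusion.isWalk_mapWalk hx⟩, ?_, ?_⟩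
  · have : (C.inclusion.mapWalk q).map Q.start =
        (q.map C.toFinQuiver.start).map C.inclusion.onV := by
      simp only [Winding.mapWalk, List.map_map]
      exact List.map_congr_left fun e _ => C.inclusion.start_letter e
    rw [this]
    exact hs.map Subtype.val_injective
  · have : (C.inclusion.mapWalk q).map Prod.fst = (q.map Prod.fst).map C.inclusion.onA := by
      simp only [Winding.mapWalk, List.map_map]
      rfl
    rw [this]
    exact ha.map Subtype.val_injective

/-- The restriction of a nice sequence is nice. -/
theorem nice_res_lt_top (C : Q.Subquiver) (h : M.nice < ⊤) : (M.res C).nice < ⊤ := by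
  obtain ⟨n, δ, hδ, hsep⟩ := M.winding.niceLength_lt_top_iff.mp h
  refine (M.res C).winding.niceLength_lt_top_iff.mpr
    ⟨n, fun j x => δ j ⟨x.1.1, x.2⟩, fun i b b' hs ht hb => ?_, fun x y hxy => ?_⟩
  · exact hδ i ⟨b.1.1, b.2⟩ ⟨b'.1.1, b'.2⟩ hs ht (congrArg Subtype.val hb)
  · refine hsep _ _ fun h => hxy ?_
    rcases x with ⟨⟨i, hi⟩, x⟩
    rcases y with ⟨⟨j, hj⟩, y⟩
    obtain ⟨rfl, h⟩ := Sigma.mk.inj h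
    obtain rfl := eq_of_heq h
    rfl

/-- Every cycle of the coefficient quiver lies over the central cycle `C`, and so survives in the
coefficient quiver of the restriction to `C`. -/
theorem isPrimitiveCycle_of_nice_res_lt_top (hQ : Q.IsPseudotree) {C : Q.Subquiver}
    (hC : C.IsCentralCycle) (h : (M.res C).nice < ⊤) {p : List M.coeffQuiver.SignedArrow}
    (hp : M.coeffQuiver.IsCycle p) : M.winding.IsPrimitiveCycle p := by
  classical
  obtain ⟨q, hq, -, -⟩ := hC
  obtain ⟨n, δ, hδ, hsep⟩ := (M.res C).winding.niceLength_lt_top_iff.mp h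
  have hover : ∀ b ∈ p.map Prod.fst, b.1 ∈ C.arrows := by
    intro b hb
    obtain ⟨f, hf, hfb⟩ := List.mem_map.mp
      (M.winding.onA_mem_of_isCycle hQ hp (Subquiver.isCycle_inclusion hq) hb)
    obtain ⟨f', -, rfl⟩ := List.mem_map.mp hf
    have hfb' : C.inclusion.onA f'.1 = b.1 := hfb
    exact hfb' ▸ Subtype.prop f'.1
  have hoverV : ∀ f ∈ p, (M.coeffQuiver.start f).1 ∈ C.verts := by
    rintro ⟨b, _ | _⟩ hf
    · exact C.tgt_mem _ (hover b (List.mem_map_of_mem hf))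
    · exact C.src_mem _ (hover b (List.mem_map_of_mem hf))
  -- a nice sequence of the restriction, continued by zero
  let δ' : ℕ → M.coeffQuiver.V → ℤ := fun j x =>
    if hx : x.1 ∈ C.verts then δ j ⟨⟨x.1, hx⟩, x.2⟩ else 0
  have hδ' : ∀ j x (hx : x.1 ∈ C.verts), δ' j x = δ j ⟨⟨x.1, hx⟩, x.2⟩ := fun j x hx => dif_pos hx
  by_contra hprim
  obtain ⟨f, hf, f', hf', hne, heq⟩ :=
    M.winding.exists_inseparable_of_not_isPrimitiveCycle hp hprim δ' fun j b hb b' hb' hs ht he => by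
      have hbC := hover b hb
      have hbC' := hover b' hb'
      have h1 : ∀ l, δ' l (M.coeffQuiver.src b) = _ := fun l => hδ' l _ (C.src_mem _ hbC)
      have h2 : ∀ l, δ' l (M.coeffQuiver.src b') = _ := fun l => hδ' l _ (C.src_mem _ hbC')
      have h3 : ∀ l, δ' l (M.coeffQuiver.tgt b) = _ := fun l => hδ' l _ (C.tgt_mem _ hbC)
      have h4 : ∀ l, δ' l (M.coeffQuiver.tgt b') = _ := fun l => hδ' l _ (C.tgt_mem _ hbC')
      rw [h1, h2, h3, h4]
      refine hδ j ⟨⟨b.1, hbC⟩, b.2⟩ ⟨⟨b'.1, hbC'⟩, b'.2⟩ (fun l => ?_) (fun l => ?_)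
        (Subtype.ext he)
      · have := hs l l.2
        rw [h1, h2] at this
        exact this
      · have := ht l l.2
        rw [h3, h4] at this
        exact this
  have hlift : ∀ (x y : M.coeffQuiver.V) (hx : x.1 ∈ C.verts) (hy : y.1 ∈ C.verts),
      (⟨⟨x.1, hx⟩, x.2⟩ : (M.res C).coeffQuiver.V) = ⟨⟨y.1, hy⟩, y.2⟩ → x = y := by
    rintro ⟨i, x⟩ ⟨j, y⟩ hx hy h
    obtain ⟨h1, h⟩ := Sigma.mk.inj h
    obtain rfl : i = j := congrArg Subtype.val h1
    obtain rfl := eq_of_heq h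
    rfl
  obtain ⟨i, -, hi⟩ := hsep _ _ fun h =>
    hne (hlift _ _ (hoverV f hf) (hoverV f' hf') h)
  have := heq i
  rw [hδ' _ _ (hoverV f hf), hδ' _ _ (hoverV f' hf')] at this
  exact hi this

end F1Rep

theorem theoremE (Q : FinQuiver.{u, v}) (M : F1Rep.{u, v, w} Q)
    (hM : M.IsIndecomposable) (hnil : M.IsNilpotent) :
    -- trees
    (M.coeffQuiver.IsTree → M.nice < ⊤) ∧
    -- type `Ã_n`
    (M.coeffQuiver.IsAffineA → (M.nice < ⊤ ↔ M.winding.IsPrimitive)) ∧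
    -- `Q` a pseudotree: the central cycle of the coefficient quiver, if it has one
    (Q.IsPseudotree →
      (∀ p, M.coeffQuiver.IsCycle p → (M.nice < ⊤ ↔ M.winding.IsPrimitiveCycle p)) ∧
      ((∀ p, ¬ M.coeffQuiver.IsCycle p) → M.nice < ⊤)) ∧
    -- `Q` a proper pseudotree with central cycle `C`
    (Q.IsProperPseudotree → ∀ C : Q.Subquiver, C.IsCentralCycle →
      (M.nice < ⊤ ↔ (M.res C).nice < ⊤)) := by
  have hconn := M.connected_coeffQuiver hM
  have htree : (∀ p, ¬ M.coeffQuiver.IsCycle p) → M.nice < ⊤ := fun h =>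
    M.winding.niceLength_lt_top_of_isTree ⟨hconn, h⟩
  refine ⟨fun h => htree h.2, fun ⟨p, hp⟩ => ⟨fun h q hq => ?_, fun h => ?_⟩,
    fun hQ => ⟨fun p hp => ⟨fun h => ?_, fun h => ?_⟩, htree⟩,
    fun hQ C hC => ⟨M.nice_res_lt_top C, fun h => ?_⟩⟩
  · exact M.winding.isPrimitiveCycle_of_niceLength_lt_top h hq.1
  · exact M.winding.niceLength_lt_top_of_isCyclePresentation hp (h p hp)
  · exact M.winding.isPrimitiveCycle_of_niceLength_lt_top h hp
  · exact M.winding.niceLength_lt_top_of_isPseudotree hQ hconn hp h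
  · by_cases hcyc : ∃ p, M.coeffQuiver.IsCycle p
    · obtain ⟨p, hp⟩ := hcyc
      exact M.winding.niceLength_lt_top_of_isPseudotree hQ.1 hconn hp
        (M.isPrimitiveCycle_of_nice_res_lt_top hQ.1 hC h hp)
    · exact htree (not_exists.mp hcyc)
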